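/- **Model.** A principal has private funds $\tau>0$; an agent privately knows the surplus (type) $x\in[\underline x,\bar x]$, where $0\le\underline x<\bar x<\infty$. The type distribution $F$ is a probability distribution on $\mathbb R$ whose support has minimum $\underline x$ and maximum $\bar x$. The cost functions $c_A,c_P:[0,1]\to\mathbb R$ are thrice differentiable, strictly increasing and strictly convex, with $c_A(0)=c_P(0)=c_A'(0)=c_P'(0)=0$. Assume $\tau\ge c_A'(1)>c_P(1)$; that $e\mapsto e\,c_A'(e)$ is strictly convex on $[0,1]$; and that $$\frac{\underline x+\tau}{c_P'(1)}+e> e(1-e)\frac{c_A'''(e)}{c_A''(e)}+1-e$$ at every $e\in[0,1]$ where $c_A''(e)\neq0$. **Mechanisms.** A tax mechanism $m=(e_A,e_P,r_A,r_P,r_\emptyset)$ consists of functions on $[\underline x,\bar x]$. It is feasible if $e_A(y),e_P(y)\in[0,1]$ and $r_A(y),r_P(y),r_\emptyset(y)\in[0,y+\tau]$ for all $y$. Let $$R_{NA}(x)=e_P(x)r_P(x)+(1-e_P(x))r_\emptyset(x),\qquad \rho_m(x)=e_A(x)\,(r_A(x)-R_{NA}(x))-c_A(e_A(x)),$$ $$U_m(x)=R_{NA}(x)+\rho_m(x),\qquad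 \lambda_m(x)=\inf_{y\in[\underline x,x]}\big(e_P(y)\,x+(1-e_P(y))(y-r_\emptyset(y))\big),$$ $$\Pi_m(x)=x-R_{NA}(x)-\rho_m(x)-c_A(e_A(x))-(1-e_A(x))\,c_P(e_P(x)).$$ (If the agent effort below is optimal for type $x$ and $e_A(x)<1$, then $\rho_m(x)=e_A(x)c_A'(e_A(x))-c_A(e_A(x))$.) The mechanism is incentive compatible if for all $x\in[\underline x,\bar x]$ the effort $e_A(x)$ maximizes $e\mapsto e\,(r_A(x)-R_{NA}(x))-c_A(e)$ over $[0,1]$, and $U_m(x)\ge x-\lambda_m(x)$. From now on, "mechanism" means feasible incentive compatible tax mechanism. A mechanism $m'$ is *tighter than* $m$ if $\Pi_m\le\Pi_{m'}$ and $\lambda_m\le\lambda_{m'}$ on $[\underline x,\bar x]$. A mechanism is *tight* if it is tighter than every mechanism that is tighter than it. A mechanism is *optimal* if its profit function is measurable and it maximizes $\int\Pi_m\,dF$ across all mechanisms with measurable profit function. For $y\in[\underline x,\bar x]$ let $$\hat X_m(y)=\{x\in[y,\bar x]:\ \lambda_m(x)=e_P(y)\,x+(1-e_P(y))(y-r_\emptyset(y))\}.$$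 A tight mechanism $m$ has *doubly unique binding ICs* if $\hat X_m(y)$ is a singleton for every $y\in(\underline x,\bar x)$, and for every $x\in(\underline x,\bar x)$ there is at most one $y\in(\underline x,\bar x)$ with $x\in\hat X_m(y)$. **Theorem.** For every optimal tight mechanism $m=(e_A,e_P,r_A,r_P,r_\emptyset)$ there is a sequence $(m_n)_{n\in\mathbb N}$ of mechanisms, with efforts $(e_{A,n},e_{P,n})$, such that: 1. each $m_n$ is tight and has doubly unique binding ICs, $e_{P,n}(x)\in(0,1)$ for all $x\in[\underline x,\bar x)$, and $e_{P,n}$ is strictly decreasing on $[\underline x,\bar x)$; 2. for all $x\in(\underline x,\bar x)$, $\ \lim_{n\to\infty}\big(e_{A,n}(x),e_{P,n}(x),\Pi_{m_n}(x)\big)=\big(e_A(x),e_P(x),\Pi_m(x)\big)$. -/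

import Mathlib

open Set MeasureTheory Filter Topology

noncomputable section

namespace TaxAudit

/-- The primitives of the model: the private funds `τ` of the principal, the lowest and highest
surplus `xlo` and `xhi` (the type space is `[xlo, xhi]`), the cost functions `cA` and `cP` of the
agent and the principal for acquiring evidence (only their values on `[0, 1]` matter), and the
distribution `F` of the type. -/
structure Environment where
  τ : ℝ
  xlo : ℝ
  xhi : ℝ
  cA : ℝ → ℝ
  cP : ℝ → ℝ
  F : Measure ℝ

/-- The `k`-th derivative of a cost function on its domain `[0, 1]` (one-sided at `0` and `1`). -/
def costDeriv (k : ℕ) (c : ℝ → ℝ) (e : ℝ) : ℝ :=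
  iteratedDerivWithin k c (Icc 0 1) e

/-- A cost function on `[0, 1]`: thrice differentiable, strictly increasing, strictly convex,
with `c 0 = c' 0 = 0`. -/
structure IsCost (c : ℝ → ℝ) : Prop where
  thrice_differentiable : ∀ k < 3, DifferentiableOn ℝ (costDeriv k c) (Icc 0 1)
  strict_mono : StrictMonoOn c (Icc 0 1)
  strict_convex : StrictConvexOn ℝ (Icc 0 1) c
  zero : c 0 = 0
  deriv_zero : costDeriv 1 c 0 = 0

/-- The assumptions on the primitives. -/
structure Environment.Admissible (E : Environment) : Prop where
  funds_pos : 0 < E.τ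
  xlo_nonneg : 0 ≤ E.xlo
  xlo_lt_xhi : E.xlo < E.xhi
  prob : IsProbabilityMeasure E.F
  min_support : IsLeast E.F.support E.xlo
  max_support : IsGreatest E.F.support E.xhi
  cost_agent : IsCost E.cA
  cost_principal : IsCost E.cP
  budget : costDeriv 1 E.cA 1 ≤ E.τ ∧ E.cP 1 < costDeriv 1 E.cA 1
  /-- The inequality is asked for only where its quotient is defined. -/
  regularity : ∀ e ∈ Icc (0 : ℝ) 1, costDeriv 2 E.cA e ≠ 0 →
    e * (1 - e) * (costDeriv 3 E.cA e / costDeriv 2 E.cA e) + 1 - e <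
      (E.xlo + E.τ) / costDeriv 1 E.cP 1 + e
  rent_regularity : StrictConvexOn ℝ (Icc 0 1) (fun e => e * costDeriv 1 E.cA e)

/-- A tax mechanism: the recommended effort `eA` of the agent, the effort `eP` of the principal,
and the refunds `rA` (the agent provided evidence), `rP` (the principal provided evidence) and
`rN` (nobody provided evidence), as functions of the advance payment.
Only the values on the type space `[xlo, xhi]` matter. -/
structure TaxMechanism where
  eA : ℝ → ℝ
  eP : ℝ → ℝ
  rA : ℝ → ℝ
  rP : ℝ → ℝ
  rN : ℝ → ℝ

/-- Expected refund when the agent provides no evidence. -/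
def TaxMechanism.refundNoAgent (m : TaxMechanism) (x : ℝ) : ℝ :=
  m.eP x * m.rP x + (1 - m.eP x) * m.rN x

/-- The expected loss of type `x` from advancing `y` and acquiring no evidence, when the full
surplus is seized after an audit. -/
def TaxMechanism.deviationLoss (m : TaxMechanism) (y x : ℝ) : ℝ :=
  m.eP y * x + (1 - m.eP y) * (y - m.rN y)

namespace Environment

variable (E : Environment)

/-- Feasibility: efforts are probabilities and refunds lie in `[0, y + τ]`. -/
def Feasible (m : TaxMechanism) : Prop :=
  ∀ y ∈ Icc E.xlo E.xhi,
    m.eA y ∈ Icc 0 1 ∧ m.eP y ∈ Icc 0 1 ∧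
    m.rA y ∈ Icc 0 (y + E.τ) ∧ m.rP y ∈ Icc 0 (y + E.τ) ∧ m.rN y ∈ Icc 0 (y + E.τ)

/-- The payoff gain of a truthful type `x`, net of effort costs, from exerting effort `e` and
disclosing the evidence so obtained. -/
def evidenceGain (m : TaxMechanism) (x e : ℝ) : ℝ :=
  e * (m.rA x - m.refundNoAgent x) - E.cA e

/-- A truthful type `x` finds the recommended effort optimal. -/
def Obedient (m : TaxMechanism) (x : ℝ) : Prop :=
  IsMaxOn (E.evidenceGain m x) (Icc 0 1) (m.eA x)

/-- The evidence rent of type `x`. -/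
def evidenceRent (m : TaxMechanism) (x : ℝ) : ℝ := E.evidenceGain m x (m.eA x)

/-- The interim utility of type `x` from advancing the full surplus. -/
def utility (m : TaxMechanism) (x : ℝ) : ℝ := m.refundNoAgent x + E.evidenceRent m x

/-- The loss function of the mechanism. -/
def loss (m : TaxMechanism) (x : ℝ) : ℝ :=
  sInf ((fun y => m.deviationLoss y x) '' Icc E.xlo x)

/-- Incentive compatibility: every type finds it optimal to exert the recommended effort and to
advance the full surplus. -/
def IncentiveCompatible (m : TaxMechanism) : Prop :=
  ∀ x ∈ Icc E.xlo E.xhi, E.Obedient m x ∧ x - E.loss m x ≤ E.utility m x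

/-- The tax mechanisms that are feasible and incentive compatible. -/
def IsMechanism (m : TaxMechanism) : Prop := E.Feasible m ∧ E.IncentiveCompatible m

/-- The principal's profit from type `x`. -/
def profit (m : TaxMechanism) (x : ℝ) : ℝ :=
  x - m.refundNoAgent x - E.evidenceRent m x - E.cA (m.eA x) - (1 - m.eA x) * E.cP (m.eP x)

/-- `u_A(e) = e c_A'(e) - c_A(e)`. -/
def rent (e : ℝ) : ℝ := e * costDeriv 1 E.cA e - E.cA e

/-- `m'` is tighter than `m`: it has a weakly higher profit and loss at every type. -/
def Tighter (m' m : TaxMechanism) : Prop :=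
  ∀ x ∈ Icc E.xlo E.xhi, E.profit m x ≤ E.profit m' x ∧ E.loss m x ≤ E.loss m' x

/-- A mechanism is tight if it is tighter than every mechanism that is tighter than it. -/
def IsTight (m : TaxMechanism) : Prop :=
  E.IsMechanism m ∧ ∀ m', E.IsMechanism m' → E.Tighter m' m → E.Tighter m m'

/-- The profit is a measurable function on the type space. -/
def MeasurableProfit (m : TaxMechanism) : Prop :=
  Measurable (fun x : Icc E.xlo E.xhi => E.profit m x)

/-- The expected profit. -/
def expectedProfit (m : TaxMechanism) : ℝ := ∫ x in Icc E.xlo E.xhi, E.profit m x ∂E.F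

/-- A mechanism is optimal if it maximizes the expected profit across all mechanisms
(with measurable profit). -/
def IsOptimal (m : TaxMechanism) : Prop :=
  (E.IsMechanism m ∧ E.MeasurableProfit m) ∧
    ∀ m', E.IsMechanism m' → E.MeasurableProfit m' → E.expectedProfit m' ≤ E.expectedProfit m

/-- The binding IC correspondence: the types `x ≥ y` whose best deviation is to `y`. -/
def bindingIC (m : TaxMechanism) (y : ℝ) : Set ℝ :=
  {x | x ∈ Icc y E.xhi ∧ E.loss m x = m.deviationLoss y x}

/-- Doubly unique binding ICs. -/
def DoublyUnique (m : TaxMechanism) : Prop :=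
  (∀ y ∈ Ioo E.xlo E.xhi, ∃! x, x ∈ E.bindingIC m y) ∧
    ∀ x ∈ Ioo E.xlo E.xhi, {y | y ∈ Ioo E.xlo E.xhi ∧ x ∈ E.bindingIC m y}.Subsingleton

/-- Where the agent effort is below `1`, the evidence rent is `u_A` of the agent effort. -/
theorem evidenceRent_eq_rent {E : Environment} {m : TaxMechanism} {x : ℝ} (hc : IsCost E.cA)
    (h : E.Obedient m x) (h0 : 0 ≤ m.eA x) (h1 : m.eA x < 1) :
    E.evidenceRent m x = E.rent (m.eA x) := by
  rcases h0.eq_or_lt with h0 | h0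
  · simp [evidenceRent, evidenceGain, rent, ← h0]
  have hmem : Icc (0 : ℝ) 1 ∈ 𝓝 (m.eA x) := Icc_mem_nhds h0 h1
  have hd : DifferentiableAt ℝ E.cA (m.eA x) := by
    have h3 := hc.thrice_differentiable 0 (by norm_num)
    have h4 : costDeriv 0 E.cA = E.cA := by
      funext e; simp [costDeriv]
    rw [h4] at h3
    exact (h3 _ ⟨h0.le, h1.le⟩).differentiableAt hmem
  have hder : costDeriv 1 E.cA (m.eA x) = deriv E.cA (m.eA x) := by
    rw [costDeriv, iteratedDerivWithin_one, derivWithin_of_mem_nhds hmem]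
  have hg : HasDerivAt (E.evidenceGain m x)
      (1 * (m.rA x - m.refundNoAgent x) - deriv E.cA (m.eA x)) (m.eA x) :=
    ((hasDerivAt_id (m.eA x)).mul_const _).sub hd.hasDerivAt
  have hz := (h.isLocalMax hmem).hasDerivAt_eq_zero hg
  rw [evidenceRent, evidenceGain, rent, hder]
  linear_combination m.eA x * hz

end Environment

end TaxAudit

end

noncomputable section

namespace TaxAudit

/-! The proof replaces mechanisms by loss functions. Fix a loss function `l` and an advance `y`.
Refunds are best shifted to the event that the principal finds evidence: then deterring every type
`z ≥ y` from advancing `y` amounts to the two families of inequalities in `auditSet`. The first is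
the loss with no refund absent evidence; the second is the loss when the refund after an audit is
maximal and the rest of the promised utility is paid without evidence. Choosing efforts thus becomes
a separate problem at each `y`: minimize `auditCost` on `auditSet`. A concave envelope of the loss
of any mechanism remains consistent with its efforts (`exists_mem_auditSet_lossHull`), so the
efforts of a tight mechanism solve these problems for its hull (`IsTight.isBest`).

The pointwise problem has exactly one solution (`IsBest.unique`). The regularity inequality makes
the virtual marginal cost of agent effort increasing, so trading the two efforts along a binding
constraint has strictly convex cost; convexity of `e * c_A'(e)` covers the case in which the utility
constraint is slack. Compactness and uniqueness give stability of the solution in `l` and `y`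
(`IsBest.tendsto`).

For a loss function that is concave, continuously differentiable, affine up to some `c` and strictly
concave afterwards, each interior advance produces a line above `l` touching it at one point. The
slopes, which are the principal efforts, decrease strictly (`snd_lt_snd`) and continuously from the
initial slope of `l` to `0`, so each type beyond `c` is touched from exactly one advance. This
yields doubly unique binding ICs. It also yields tightness (`eq_of_profitable`): a larger, weakly
more profitable loss function could not first separate from `l`, since types just above the
separation point are touched from advances where the two still agree.

The hull of the given mechanism's loss is approximated uniformly by such functions; stability
transports efforts and profits to the limit. -/

theorem costDeriv_zero (c : ℝ → ℝ) : costDeriv 0 c = c := by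
  funext e; simp [costDeriv]

/-- A function that is minimal at `x` among nearby points to the left has nonpositive derivative. -/
theorem hasDerivAt_nonpos_of_eventually_left {f : ℝ → ℝ} {d x : ℝ} (hf : HasDerivAt f d x)
    (h : ∀ᶠ e in 𝓝[<] x, f x ≤ f e) : d ≤ 0 := by
  have ht := (hasDerivWithinAt_iff_tendsto_slope' (s := Iio x) (by simp)).1 hf.hasDerivWithinAt
  refine le_of_tendsto ht ?_
  filter_upwards [h, self_mem_nhdsWithin] with e he hex
  rw [slope_def_field]
  exact div_nonpos_of_nonneg_of_nonpos (by linarith) (by linarith [mem_Iio.1 hex])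

/-- A function that is minimal at `x` among nearby points to the right has nonnegative
derivative. -/
theorem hasDerivAt_nonneg_of_eventually_right {f : ℝ → ℝ} {d x : ℝ} (hf : HasDerivAt f d x)
    (h : ∀ᶠ e in 𝓝[>] x, f x ≤ f e) : 0 ≤ d := by
  have ht := (hasDerivWithinAt_iff_tendsto_slope' (s := Ioi x) (by simp)).1 hf.hasDerivWithinAt
  refine ge_of_tendsto ht ?_
  filter_upwards [h, self_mem_nhdsWithin] with e he hex
  rw [slope_def_field]
  exact div_nonneg (by linarith) (by linarith [mem_Ioi.1 hex])

/-! ### Calculus of cost functions and their extension to the line -/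

namespace IsCost

variable {c : ℝ → ℝ}

theorem hasDerivWithinAt (hc : IsCost c) {k : ℕ} (hk : k < 3) {e : ℝ} (he : e ∈ Icc (0 : ℝ) 1) :
    HasDerivWithinAt (costDeriv k c) (costDeriv (k + 1) c e) (Icc 0 1) e := by
  have h := (hc.thrice_differentiable k hk e he).hasDerivWithinAt
  have h2 : costDeriv (k + 1) c e = derivWithin (costDeriv k c) (Icc 0 1) e := by
    unfold costDeriv
    rw [iteratedDerivWithin_succ]
  rwa [h2]

theorem hasDerivAt (hc : IsCost c) {k : ℕ} (hk : k < 3) {e : ℝ} (he : e ∈ Ioo (0 : ℝ) 1) :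
    HasDerivAt (costDeriv k c) (costDeriv (k + 1) c e) e :=
  (hc.hasDerivWithinAt hk (Ioo_subset_Icc_self he)).hasDerivAt (Icc_mem_nhds he.1 he.2)

theorem hasDerivAt_self (hc : IsCost c) {e : ℝ} (he : e ∈ Ioo (0 : ℝ) 1) :
    HasDerivAt c (costDeriv 1 c e) e := by
  simpa [costDeriv_zero] using hc.hasDerivAt (k := 0) (by norm_num) he

theorem hasDerivWithinAt_self (hc : IsCost c) {e : ℝ} (he : e ∈ Icc (0 : ℝ) 1) :
    HasDerivWithinAt c (costDeriv 1 c e) (Icc 0 1) e := by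
  simpa [costDeriv_zero] using hc.hasDerivWithinAt (k := 0) (by norm_num) he

theorem continuousOn_costDeriv (hc : IsCost c) {k : ℕ} (hk : k < 3) :
    ContinuousOn (costDeriv k c) (Icc 0 1) :=
  (hc.thrice_differentiable k hk).continuousOn

theorem continuousOn (hc : IsCost c) : ContinuousOn c (Icc 0 1) := by
  simpa [costDeriv_zero] using hc.continuousOn_costDeriv (k := 0) (by norm_num)

theorem tangent_lt (hc : IsCost c) {e e' : ℝ} (he : e ∈ Icc (0 : ℝ) 1) (he' : e' ∈ Icc (0 : ℝ) 1)
    (hne : e ≠ e') : c e + costDeriv 1 c e * (e' - e) < c e' := by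
  have hd := hc.hasDerivWithinAt_self he
  rcases hne.lt_or_gt with h | h
  · have := hc.strict_convex.lt_slope_of_hasDerivWithinAt he he' h hd
    rw [slope_def_field, lt_div_iff₀ (by linarith)] at this
    linarith
  · have := hc.strict_convex.slope_lt_of_hasDerivWithinAt he' he h hd
    rw [slope_def_field, div_lt_iff₀ (by linarith)] at this
    linarith

theorem tangent_le (hc : IsCost c) {e e' : ℝ} (he : e ∈ Icc (0 : ℝ) 1) (he' : e' ∈ Icc (0 : ℝ) 1) :
    c e + costDeriv 1 c e * (e' - e) ≤ c e' := by
  rcases eq_or_ne e e' with rfl | h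
  · simp
  · exact (hc.tangent_lt he he' h).le

theorem deriv_strictMono (hc : IsCost c) : StrictMonoOn (costDeriv 1 c) (Icc 0 1) := by
  intro e he e' he' h
  have h1 := hc.tangent_lt he he' h.ne
  have h2 := hc.tangent_lt he' he h.ne'
  nlinarith

theorem deriv_nonneg (hc : IsCost c) {e : ℝ} (he : e ∈ Icc (0 : ℝ) 1) : 0 ≤ costDeriv 1 c e := by
  rw [← hc.deriv_zero]
  exact hc.deriv_strictMono.monotoneOn ⟨le_rfl, zero_le_one⟩ he he.1

theorem deriv_one_pos (hc : IsCost c) : 0 < costDeriv 1 c 1 := by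
  rw [← hc.deriv_zero]
  exact hc.deriv_strictMono ⟨le_rfl, zero_le_one⟩ ⟨zero_le_one, le_rfl⟩ zero_lt_one

theorem deriv_two_nonneg (hc : IsCost c) {e : ℝ} (he : e ∈ Ioo (0 : ℝ) 1) :
    0 ≤ costDeriv 2 c e := by
  have hs : 0 ≤ derivWithin (costDeriv 1 c) (Icc 0 1) e :=
    hc.deriv_strictMono.monotoneOn.derivWithin_nonneg
  rwa [(hc.hasDerivWithinAt (k := 1) (by norm_num) (Ioo_subset_Icc_self he)).derivWithin
    (uniqueDiffOn_Icc zero_lt_one e (Ioo_subset_Icc_self he))] at hs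

/-- Where the second derivative vanishes, so does the third. -/
theorem deriv_three_eq_zero (hc : IsCost c) {e : ℝ} (he : e ∈ Ioo (0 : ℝ) 1)
    (h : costDeriv 2 c e = 0) : costDeriv 3 c e = 0 := by
  have hd := hc.hasDerivAt (k := 2) (by norm_num) he
  refine IsLocalMin.hasDerivAt_eq_zero ?_ hd
  filter_upwards [Ioo_mem_nhds he.1 he.2] with t ht
  rw [h]
  exact hc.deriv_two_nonneg ht

end IsCost

/-- The marginal cost frozen outside of `[0, 1]`. -/
def costExtDeriv (c : ℝ → ℝ) (t : ℝ) : ℝ :=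
  costDeriv 1 c (projIcc (0 : ℝ) 1 zero_le_one t)

/-- The extension of a cost function to the line with the marginal cost `costExtDeriv`. -/
def costExt (c : ℝ → ℝ) (t : ℝ) : ℝ :=
  ∫ s in (0 : ℝ)..t, costExtDeriv c s

namespace IsCost

variable {c : ℝ → ℝ}

theorem continuous_costExtDeriv (hc : IsCost c) : Continuous (costExtDeriv c) :=
  (hc.continuousOn_costDeriv (k := 1) (by norm_num)).comp_continuous
    (continuous_subtype_val.comp continuous_projIcc) fun t => (projIcc (0 : ℝ) 1 zero_le_one t).2

theorem costExtDeriv_eq {e : ℝ} (he : e ∈ Icc (0 : ℝ) 1) :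
    costExtDeriv c e = costDeriv 1 c e := by
  rw [costExtDeriv, projIcc_of_mem _ he]

theorem costExtDeriv_nonneg (hc : IsCost c) (t : ℝ) : 0 ≤ costExtDeriv c t :=
  hc.deriv_nonneg (projIcc (0 : ℝ) 1 zero_le_one t).2

theorem costExtDeriv_mono (hc : IsCost c) : Monotone (costExtDeriv c) := fun s t hst =>
  hc.deriv_strictMono.monotoneOn (projIcc (0 : ℝ) 1 zero_le_one s).2
    (projIcc (0 : ℝ) 1 zero_le_one t).2 (monotone_projIcc _ hst)

theorem costExtDeriv_le (hc : IsCost c) (t : ℝ) : costExtDeriv c t ≤ costDeriv 1 c 1 :=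
  hc.deriv_strictMono.monotoneOn (projIcc (0 : ℝ) 1 zero_le_one t).2
    ⟨zero_le_one, le_rfl⟩ (projIcc (0 : ℝ) 1 zero_le_one t).2.2

theorem costExtDeriv_of_nonpos (hc : IsCost c) {t : ℝ} (ht : t ≤ 0) : costExtDeriv c t = 0 := by
  rw [costExtDeriv, projIcc_of_le_left _ ht]
  exact hc.deriv_zero

theorem hasDerivAt_costExt (hc : IsCost c) (t : ℝ) :
    HasDerivAt (costExt c) (costExtDeriv c t) t :=
  intervalIntegral.integral_hasDerivAt_right (hc.continuous_costExtDeriv.intervalIntegrable _ _)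
    hc.continuous_costExtDeriv.stronglyMeasurable.stronglyMeasurableAtFilter
    hc.continuous_costExtDeriv.continuousAt

theorem continuous_costExt (hc : IsCost c) : Continuous (costExt c) :=
  continuous_iff_continuousAt.2 fun t => (hc.hasDerivAt_costExt t).continuousAt

theorem costExt_mono (hc : IsCost c) : Monotone (costExt c) :=
  monotone_of_hasDerivAt_nonneg hc.hasDerivAt_costExt hc.costExtDeriv_nonneg

/-- Both functions have the same derivative within `[0, 1]` and both vanish at `0`. -/
theorem costExt_eq (hc : IsCost c) {e : ℝ} (he : e ∈ Icc (0 : ℝ) 1) : costExt c e = c e := by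
  have h : ∀ t ∈ Icc (0 : ℝ) 1, costExt c t - c t = costExt c 0 - c 0 := by
    refine constant_of_derivWithin_zero (f := fun t => costExt c t - c t) ?_ ?_
    · intro t ht
      exact ((hc.hasDerivAt_costExt t).hasDerivWithinAt.sub
        (hc.hasDerivWithinAt_self ht)).differentiableWithinAt
    · intro t ht
      have ht' := Ico_subset_Icc_self ht
      have := ((hc.hasDerivAt_costExt t).hasDerivWithinAt.sub
        (hc.hasDerivWithinAt_self ht')).derivWithin (uniqueDiffOn_Icc zero_lt_one t ht')
      rw [costExtDeriv_eq ht', sub_self] at this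
      exact this
  have := h e he
  rw [hc.zero, show costExt c 0 = 0 by simp [costExt]] at this
  linarith

end IsCost

namespace Environment

/-! ### Evidence rent, virtual cost and the trade-off between efforts -/

section Costs

variable {E : Environment}

theorem rent_zero (hE : E.Admissible) : E.rent 0 = 0 := by
  simp [rent, hE.cost_agent.zero]

theorem continuousOn_rent (hE : E.Admissible) : ContinuousOn E.rent (Icc 0 1) :=
  (continuousOn_id.mul (hE.cost_agent.continuousOn_costDeriv (by norm_num))).sub
    hE.cost_agent.continuousOn

/-- The rent is minus the intercept of the tangent of `c_A` at `e`, and intercepts of tangents of a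
strictly convex function decrease. Tangents are used because the derivative `e * c_A''(e)` may
vanish at some points. -/
theorem rent_strictMono (hE : E.Admissible) : StrictMonoOn E.rent (Icc 0 1) := by
  intro e he e' he' h
  have h1 := hE.cost_agent.tangent_lt he' he h.ne'
  have h2 := hE.cost_agent.deriv_strictMono he he' h
  have h3 := he.1
  simp only [rent]
  nlinarith

theorem rent_nonneg (hE : E.Admissible) {e : ℝ} (he : e ∈ Icc (0 : ℝ) 1) : 0 ≤ E.rent e := by
  rw [← rent_zero hE]
  exact (rent_strictMono hE).monotoneOn ⟨le_rfl, zero_le_one⟩ he he.1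

theorem hasDerivAt_rent (hE : E.Admissible) {e : ℝ} (he : e ∈ Ioo (0 : ℝ) 1) :
    HasDerivAt E.rent (e * costDeriv 2 E.cA e) e := by
  have h := ((hasDerivAt_id e).mul (hE.cost_agent.hasDerivAt (k := 1) (by norm_num) he)).sub
    (hE.cost_agent.hasDerivAt_self he)
  refine h.congr_deriv ?_
  simp

theorem xlo_add_τ_pos (hE : E.Admissible) : 0 < E.xlo + E.τ :=
  add_pos_of_nonneg_of_pos hE.xlo_nonneg hE.funds_pos

/-- The regularity assumption in the form in which it is used: the virtual marginal cost of the
agent effort is increasing. -/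
theorem virtualCost_strictMono (hE : E.Admissible) {κ : ℝ} (h0 : 0 ≤ κ)
    (h1 : κ * (E.xlo + E.τ) ≤ costDeriv 1 E.cP 1) :
    StrictMonoOn (fun e => costDeriv 1 E.cA e - κ * ((1 - e) * (e * costDeriv 2 E.cA e)))
      (Ioo 0 1) := by
  have hc := hE.cost_agent
  set A1 := costDeriv 1 E.cA
  set A2 := costDeriv 2 E.cA with hA2
  set A3 := costDeriv 3 E.cA with hA3
  have hd : ∀ e ∈ Ioo (0 : ℝ) 1,
      HasDerivAt (fun e => A1 e - κ * ((1 - e) * (e * A2 e)))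
        (A2 e - κ * ((1 - 2 * e) * A2 e + (1 - e) * e * A3 e)) e := by
    intro e he
    have h := (hc.hasDerivAt (k := 1) (by norm_num) he).sub
      ((((hasDerivAt_id e).const_sub 1).mul
        ((hasDerivAt_id e).mul (hc.hasDerivAt (k := 2) (by norm_num) he))).const_mul κ)
    refine h.congr_deriv ?_
    change A2 e - κ * (-1 * (e * A2 e) + (1 - e) * (1 * A2 e + e * A3 e)) = _
    ring
  have hpos : ∀ e ∈ Ioo (0 : ℝ) 1, A2 e ≠ 0 →
      0 < A2 e - κ * ((1 - 2 * e) * A2 e + (1 - e) * e * A3 e) := by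
    intro e he hne
    have hA : 0 < A2 e := lt_of_le_of_ne (hc.deriv_two_nonneg he) (Ne.symm hne)
    have hreg := hE.regularity e (Ioo_subset_Icc_self he) hne
    have hP := hE.cost_principal.deriv_one_pos
    have ha := xlo_add_τ_pos hE
    -- The derivative factors as `A2 e * (1 - κ * B)`. Regularity bounds `B` by `(xlo + τ) /
    -- c_P'(1)`, and the bound on `κ` is exactly what turns this into `κ * B < 1`.
    set B := e * (1 - e) * (A3 e / A2 e) + 1 - 2 * e with hB
    have h2 : B < (E.xlo + E.τ) / costDeriv 1 E.cP 1 := by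
      rw [hB]; linarith
    rw [lt_div_iff₀ hP] at h2
    have h3 : κ * B < 1 := by
      rcases le_or_gt B 0 with h | h
      · nlinarith
      · have : κ * B * (E.xlo + E.τ) < 1 * (E.xlo + E.τ) := by nlinarith
        exact lt_of_mul_lt_mul_right this ha.le
    have h4 : A2 e - κ * ((1 - 2 * e) * A2 e + (1 - e) * e * A3 e) = A2 e * (1 - κ * B) := by
      rw [hB]; field_simp; ring
    rw [h4]
    exact mul_pos hA (by linarith)
  have hnn : ∀ e ∈ Ioo (0 : ℝ) 1,
      0 ≤ A2 e - κ * ((1 - 2 * e) * A2 e + (1 - e) * e * A3 e) := by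
    intro e he
    by_cases h : A2 e = 0
    · have : A3 e = 0 := hc.deriv_three_eq_zero he h
      rw [h, this]; simp
    · exact (hpos e he h).le
  have hmono : MonotoneOn (fun e => A1 e - κ * ((1 - e) * (e * A2 e))) (Ioo 0 1) := by
    refine monotoneOn_of_hasDerivWithinAt_nonneg (convex_Ioo 0 1)
      (fun e he => (hd e he).continuousAt.continuousWithinAt)
      (fun e he => (hd e (interior_subset he)).hasDerivWithinAt)
      (fun e he => hnn e (interior_subset he))
  intro e he e' he' hlt
  refine lt_of_le_of_ne (hmono he he' hlt.le) fun heq => ?_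
  -- Equal values at the ends of a monotone stretch make the function constant there, so its
  -- derivative is zero, which is impossible where `A2` is nonzero. Then `c_A'` would be constant,
  -- against strict convexity.
  have hz : ∀ t ∈ Ioo e e', A2 t = 0 := by
    intro t ht
    have ht' : t ∈ Ioo (0 : ℝ) 1 := ⟨he.1.trans ht.1, ht.2.trans he'.2⟩
    by_contra hne
    have hconst : HasDerivAt (fun e => A1 e - κ * ((1 - e) * (e * A2 e))) 0 t := by
      refine (hasDerivAt_const t (A1 e - κ * ((1 - e) * (e * A2 e)))).congr_of_eventuallyEq ?_
      filter_upwards [Ioo_mem_nhds ht.1 ht.2] with u hu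
      have hu' : u ∈ Ioo (0 : ℝ) 1 := ⟨he.1.trans hu.1, hu.2.trans he'.2⟩
      refine le_antisymm ?_ (hmono he hu' hu.1.le)
      exact (hmono hu' he' hu.2.le).trans heq.ge
    exact (hpos t ht' hne).ne ((hd t ht').unique hconst).symm
  obtain ⟨t, ht, heq2⟩ := exists_hasDerivAt_eq_slope A1 A2 hlt
    (fun u hu => (hc.hasDerivAt (k := 1) (by norm_num)
      ⟨he.1.trans_le hu.1, hu.2.trans_lt he'.2⟩).continuousAt.continuousWithinAt)
    (fun u hu => hc.hasDerivAt (k := 1) (by norm_num) ⟨he.1.trans hu.1, hu.2.trans he'.2⟩)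
  rw [hz t ht] at heq2
  have := hc.deriv_strictMono (Ioo_subset_Icc_self he) (Ioo_subset_Icc_self he') hlt
  have h5 : 0 < (A1 e' - A1 e) / (e' - e) := div_pos (by linarith) (by linarith)
  linarith

/-- The cost of the efforts `e` and `(k - E.rent e) / w`. -/
def tradeoff (E : Environment) (k w e : ℝ) : ℝ :=
  E.cA e + (1 - e) * costExt E.cP ((k - E.rent e) / w)

theorem hasDerivAt_tradeoff (hE : E.Admissible) (k w : ℝ) {e : ℝ} (he : e ∈ Ioo (0 : ℝ) 1) :
    HasDerivAt (E.tradeoff k w)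
      (costDeriv 1 E.cA e - costExt E.cP ((k - E.rent e) / w) -
        costExtDeriv E.cP ((k - E.rent e) / w) / w * ((1 - e) * (e * costDeriv 2 E.cA e))) e := by
  have h1 : HasDerivAt (fun e => (k - E.rent e) / w) (-(e * costDeriv 2 E.cA e) / w) e :=
    ((hasDerivAt_rent hE he).const_sub k).div_const w
  have h2 := (hE.cost_principal.hasDerivAt_costExt ((k - E.rent e) / w)).comp e h1
  have h3 := (hE.cost_agent.hasDerivAt_self he).add
    (((hasDerivAt_id e).const_sub 1).mul h2)
  refine h3.congr_deriv ?_
  simp only [id, Function.comp]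
  ring

theorem continuousOn_tradeoff (hE : E.Admissible) (k w : ℝ) :
    ContinuousOn (E.tradeoff k w) (Icc 0 1) :=
  hE.cost_agent.continuousOn.add ((continuousOn_const.sub continuousOn_id).mul
    (hE.cost_principal.continuous_costExt.comp_continuousOn
      ((continuousOn_const.sub (continuousOn_rent hE)).div_const w)))

/-- The derivative is the virtual cost with weight `κ = costExtDeriv E.cP p / w`, minus `costExt
E.cP p`, where `p` is the compensating principal effort. As `e` grows, `p` falls, so `κ` and the
subtracted cost fall as well; both effects reinforce the monotonicity of the virtual cost at fixed
`κ`. The extension of `c_P` is needed because `p` may leave `[0, 1]`. -/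
theorem tradeoff_strictConvex (hE : E.Admissible) {w : ℝ} (k : ℝ) (hw : E.xlo + E.τ ≤ w) :
    StrictConvexOn ℝ (Icc 0 1) (E.tradeoff k w) := by
  have ha := xlo_add_τ_pos hE
  have hw0 : 0 < w := ha.trans_le hw
  have hcP := hE.cost_principal
  refine StrictMonoOn.strictConvexOn_of_deriv (convex_Icc 0 1) (continuousOn_tradeoff hE k w) ?_
  rw [interior_Icc]
  intro e he e' he' hlt
  rw [(hasDerivAt_tradeoff hE k w he).deriv, (hasDerivAt_tradeoff hE k w he').deriv]
  have hr := rent_strictMono hE (Ioo_subset_Icc_self he) (Ioo_subset_Icc_self he') hlt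
  have hh : (k - E.rent e') / w ≤ (k - E.rent e) / w :=
    div_le_div_of_nonneg_right (by linarith) hw0.le
  have hκ : costExtDeriv E.cP ((k - E.rent e') / w) / w ≤
      costExtDeriv E.cP ((k - E.rent e) / w) / w :=
    div_le_div_of_nonneg_right (hcP.costExtDeriv_mono hh) hw0.le
  have hv := virtualCost_strictMono hE
    (κ := costExtDeriv E.cP ((k - E.rent e) / w) / w)
    (div_nonneg (hcP.costExtDeriv_nonneg _) hw0.le) (by
      rw [div_mul_eq_mul_div, div_le_iff₀ hw0]
      exact mul_le_mul (hcP.costExtDeriv_le _) hw ha.le hcP.deriv_one_pos.le) he he' hlt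
  simp only at hv
  have h4 := hcP.costExt_mono hh
  have h5 : 0 ≤ (1 - e') * (e' * costDeriv 2 E.cA e') :=
    mul_nonneg (by linarith [he'.2]) (mul_nonneg he'.1.le (hE.cost_agent.deriv_two_nonneg he'))
  nlinarith

end Costs

/-! ### The effort problem at one advance: existence, uniqueness, stability -/

section PointwiseProblem

variable {E : Environment}

/-- The properties of a loss function that the pointwise design problem needs. -/
structure IsLossFn (E : Environment) (l : ℝ → ℝ) : Prop where
  mono : Monotone l
  lip : ∀ x z, x ≤ z → l z - l x ≤ z - x
  at_lo : l E.xlo = E.xlo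

/-- The efforts `(e, p)` of agent and principal with which the advance `y` can be made
consistent with the loss function `l`. -/
def auditSet (E : Environment) (l : ℝ → ℝ) (y : ℝ) : Set (ℝ × ℝ) :=
  {q | q.1 ∈ Icc 0 1 ∧ q.2 ∈ Icc 0 1 ∧ ∀ z ∈ Icc y E.xhi,
    l z ≤ y + q.2 * (z - y) ∧ l z ≤ l y + E.rent q.1 + q.2 * (z + E.τ)}

/-- The least cost (inclusive of the payoff of the agent, net of the surplus) of the efforts `q`
at the advance `y` if the loss is `v`. -/
def auditCost (E : Environment) (v y : ℝ) (q : ℝ × ℝ) : ℝ :=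
  E.cA q.1 + max (-v) (E.rent q.1 - y) + (1 - q.1) * E.cP q.2

/-- The efforts `q` are optimal at the advance `y` given the loss function `l`. -/
def IsBest (E : Environment) (l : ℝ → ℝ) (y : ℝ) (q : ℝ × ℝ) : Prop :=
  q ∈ E.auditSet l y ∧ ∀ q' ∈ E.auditSet l y, E.auditCost (l y) y q ≤ E.auditCost (l y) y q'

namespace IsLossFn

variable {l : ℝ → ℝ}

theorem continuous (hl : E.IsLossFn l) : Continuous l := by
  have : LipschitzWith 1 l := by
    refine LipschitzWith.of_le_add fun x z => ?_
    rcases le_total x z with h | h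
    · have := hl.mono h
      have := dist_nonneg (x := x) (y := z)
      linarith
    · have := hl.lip z x h
      rw [Real.dist_eq, abs_of_nonneg (by linarith)]
      linarith
  exact this.continuous

theorem le_self (hl : E.IsLossFn l) {x : ℝ} (hx : E.xlo ≤ x) : l x ≤ x := by
  have := hl.lip _ _ hx
  rw [hl.at_lo] at this
  linarith

theorem lo_le (hl : E.IsLossFn l) {x : ℝ} (hx : E.xlo ≤ x) : E.xlo ≤ l x := by
  have := hl.mono hx
  rwa [hl.at_lo] at this

end IsLossFn

/-- A certain audit deters every deviation whatever the agent effort, so the problem is never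
infeasible and this choice serves as a universal competitor. -/
theorem full_audit_mem (hE : E.Admissible) {l : ℝ → ℝ} (hl : E.IsLossFn l) {y : ℝ}
    (hy : E.xlo ≤ y) {e : ℝ} (he : e ∈ Icc (0 : ℝ) 1) : (e, (1 : ℝ)) ∈ E.auditSet l y := by
  refine ⟨he, ⟨zero_le_one, le_rfl⟩, fun z hz => ?_⟩
  have h1 := hl.le_self (hy.trans hz.1)
  have h2 := hl.lo_le hy
  have h3 := rent_nonneg hE he
  have h4 := xlo_add_τ_pos hE
  have h5 := hE.xlo_nonneg
  have h6 := hE.funds_pos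
  constructor <;> simp only <;> linarith

theorem isCompact_auditSet (hE : E.Admissible) (l : ℝ → ℝ) (y : ℝ) :
    IsCompact (E.auditSet l y) := by
  have hS : IsCompact (Icc (0 : ℝ) 1 ×ˢ Icc (0 : ℝ) 1) := isCompact_Icc.prod isCompact_Icc
  have hr : ContinuousOn (fun q : ℝ × ℝ => E.rent q.1) (Icc (0 : ℝ) 1 ×ˢ Icc (0 : ℝ) 1) :=
    (continuousOn_rent hE).comp continuousOn_fst fun q hq => hq.1
  refine hS.of_isClosed_subset ?_ fun q hq => ⟨hq.1, hq.2.1⟩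
  -- The rent is known to be continuous only on `[0, 1]`, so each constraint is intersected with the
  -- square before taking preimages.
  have : E.auditSet l y = (Icc (0 : ℝ) 1 ×ˢ Icc (0 : ℝ) 1) ∩ ⋂ z ∈ Icc y E.xhi,
      ((Icc (0 : ℝ) 1 ×ˢ Icc (0 : ℝ) 1) ∩ (fun q : ℝ × ℝ => min (y + q.2 * (z - y))
        (l y + E.rent q.1 + q.2 * (z + E.τ)) - l z) ⁻¹' Ici 0) := by
    ext q
    simp only [auditSet, mem_ofPred_eq, mem_inter_iff, mem_iInter, mem_preimage, mem_Ici,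
      sub_nonneg, le_min_iff, mem_prod]
    constructor
    · rintro ⟨h1, h2, h3⟩
      exact ⟨⟨h1, h2⟩, fun z hz => ⟨⟨h1, h2⟩, h3 z hz⟩⟩
    · rintro ⟨⟨h1, h2⟩, h3⟩
      exact ⟨h1, h2, fun z hz => (h3 z hz).2⟩
  rw [this]
  refine hS.isClosed.inter (isClosed_biInter fun z _ => ?_)
  refine ContinuousOn.preimage_isClosed_of_isClosed ?_ hS.isClosed isClosed_Ici
  refine ContinuousOn.sub (continuous_min.comp_continuousOn (ContinuousOn.prodMk ?_ ?_))
    continuousOn_const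
  · exact (by fun_prop : Continuous fun q : ℝ × ℝ => y + q.2 * (z - y)).continuousOn
  · exact (continuousOn_const.add hr).add
      (by fun_prop : Continuous fun q : ℝ × ℝ => q.2 * (z + E.τ)).continuousOn

theorem tendsto_auditCost (hE : E.Admissible) {ι : Type*} {F : Filter ι} {v y : ι → ℝ}
    {q : ι → ℝ × ℝ} {v₀ y₀ : ℝ} {q₀ : ℝ × ℝ} (hv : Tendsto v F (𝓝 v₀)) (hy : Tendsto y F (𝓝 y₀))
    (hq : Tendsto q F (𝓝 q₀)) (hmem : ∀ᶠ i in F, (q i).1 ∈ Icc (0 : ℝ) 1 ∧ (q i).2 ∈ Icc (0 : ℝ) 1)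
    (h₀ : q₀.1 ∈ Icc (0 : ℝ) 1 ∧ q₀.2 ∈ Icc (0 : ℝ) 1) :
    Tendsto (fun i => E.auditCost (v i) (y i) (q i)) F (𝓝 (E.auditCost v₀ y₀ q₀)) := by
  have h1 : Tendsto (fun i => (q i).1) F (𝓝[Icc 0 1] q₀.1) :=
    tendsto_nhdsWithin_iff.2 ⟨(continuous_fst.tendsto _).comp hq, hmem.mono fun i h => h.1⟩
  have h2 : Tendsto (fun i => (q i).2) F (𝓝[Icc 0 1] q₀.2) :=
    tendsto_nhdsWithin_iff.2 ⟨(continuous_snd.tendsto _).comp hq, hmem.mono fun i h => h.2⟩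
  have hA := (hE.cost_agent.continuousOn _ h₀.1).tendsto.comp h1
  have hR := (continuousOn_rent hE _ h₀.1).tendsto.comp h1
  have hP := (hE.cost_principal.continuousOn _ h₀.2).tendsto.comp h2
  exact (hA.add (hv.neg.max (hR.sub hy))).add
    (((tendsto_nhds_of_tendsto_nhdsWithin h1).const_sub 1).mul hP)

theorem exists_isBest (hE : E.Admissible) {l : ℝ → ℝ} (hl : E.IsLossFn l) {y : ℝ}
    (hy : E.xlo ≤ y) : ∃ q, E.IsBest l y q := by
  have hne : (E.auditSet l y).Nonempty :=
    ⟨_, full_audit_mem hE hl hy (e := 0) ⟨le_rfl, zero_le_one⟩⟩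
  have hcont : ContinuousOn (E.auditCost (l y) y) (E.auditSet l y) := by
    intro q hq
    refine tendsto_auditCost hE tendsto_const_nhds tendsto_const_nhds
      (tendsto_nhds_of_tendsto_nhdsWithin tendsto_id) ?_ ⟨hq.1, hq.2.1⟩
    filter_upwards [self_mem_nhdsWithin] with r hr
    exact ⟨hr.1, hr.2.1⟩
  obtain ⟨q, hq, hmin⟩ := (isCompact_auditSet hE l y).exists_isMinOn hne hcont
  exact ⟨q, hq, fun q' hq' => hmin hq'⟩

/-- Full effort of the agent is dominated. -/
theorem exists_full_audit_cost_lt (hE : E.Admissible) (v y : ℝ) :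
    ∃ e ∈ Ico (0 : ℝ) 1, ∀ p,
      E.auditCost v y (e, 1) < E.auditCost v y (1, p) := by
  have hc := hE.cost_agent
  have h1 : (1 : ℝ) ∈ Icc (0 : ℝ) 1 := ⟨zero_le_one, le_rfl⟩
  have hcont := (hc.continuousOn_costDeriv (k := 1) (by norm_num)) 1 h1
  -- Since `c_P(1) < c_A'(1)`, lowering agent effort slightly below `1` saves more than the cost of
  -- auditing with certainty on the event that the agent finds nothing.
  have hev : ∀ᶠ e in 𝓝[Icc (0 : ℝ) 1] 1, E.cP 1 < costDeriv 1 E.cA e :=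
    hcont.eventually (lt_mem_nhds hE.budget.2)
  have hle : 𝓝[Ico (0 : ℝ) 1] 1 ≤ 𝓝[Icc (0 : ℝ) 1] 1 := nhdsWithin_mono _ Ico_subset_Icc_self
  have hne : (𝓝[Ico (0 : ℝ) 1] (1 : ℝ)).NeBot := by
    rw [nhdsWithin_Ico_eq_nhdsLT zero_lt_one]; infer_instance
  obtain ⟨e, he, hmem⟩ := ((hev.filter_mono hle).and self_mem_nhdsWithin).exists
  refine ⟨e, hmem, fun p => ?_⟩
  have he' := Ico_subset_Icc_self hmem
  have ht := hc.tangent_le he' h1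
  have hr := (rent_strictMono hE).monotoneOn he' h1 hmem.2.le
  have hm : max (-v) (E.rent e - y) ≤ max (-v) (E.rent 1 - y) := max_le_max le_rfl (by linarith)
  simp only [auditCost, sub_self, zero_mul, add_zero]
  have : (1 - e) * E.cP 1 < costDeriv 1 E.cA e * (1 - e) := by
    rw [mul_comm]
    exact mul_lt_mul_of_pos_right he (by linarith [hmem.2])
  linarith

namespace IsBest

variable {l : ℝ → ℝ} {y : ℝ} {q : ℝ × ℝ}

theorem lt_one (hE : E.Admissible) (hl : E.IsLossFn l) (hy : E.xlo ≤ y) (h : E.IsBest l y q) :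
    q.1 < 1 := by
  refine lt_of_le_of_ne h.1.1.2 fun heq => ?_
  obtain ⟨e, he, hlt⟩ := exists_full_audit_cost_lt hE (l y) y
  have h1 := h.2 _ (full_audit_mem hE hl hy (Ico_subset_Icc_self he))
  exact absurd h1 (not_le.2 (by simpa [← heq] using hlt q.2))

/-- The principal effort is the least one that is consistent with the agent effort. -/
theorem le_of_mem (hE : E.Admissible) (hl : E.IsLossFn l) (hy : E.xlo ≤ y) (h : E.IsBest l y q)
    {p : ℝ} (hp : (q.1, p) ∈ E.auditSet l y) : q.2 ≤ p := by
  by_contra hlt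
  push Not at hlt
  have h1 := h.2 _ hp
  have h2 := hE.cost_principal.strict_mono hp.2.1 h.1.2.1 hlt
  have h3 := h.lt_one hE hl hy
  simp only [auditCost] at h1
  nlinarith

end IsBest

/-- A continuous function that is positive on a compact set has a positive lower bound there. -/
theorem exists_pos_forall_le {f : ℝ → ℝ} (hf : Continuous f) {K : Set ℝ} (hK : IsCompact K)
    (hpos : ∀ z ∈ K, 0 < f z) : ∃ σ > 0, ∀ z ∈ K, σ ≤ f z := by
  rcases K.eq_empty_or_nonempty with rfl | hne
  · exact ⟨1, one_pos, by simp⟩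
  · obtain ⟨z, hz, hmin⟩ := hK.exists_isMinOn hne hf.continuousOn
    exact ⟨f z, hpos z hz, fun w hw => hmin hw⟩

/-- The part of the objective that does not depend on the principal effort is strictly convex. -/
theorem strictConvexOn_agentCost (hE : E.Admissible) (v y : ℝ) :
    StrictConvexOn ℝ (Icc 0 1) (fun e => E.cA e + max (-v) (E.rent e - y)) := by
  -- The sum equals the maximum of `c_A(e) - v` and `e * c_A'(e) - y`, two strictly convex
  -- functions.
  have h1 : StrictConvexOn ℝ (Icc 0 1) (fun e => E.cA e + -v) :=
    hE.cost_agent.strict_convex.add_const _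
  have h2 : StrictConvexOn ℝ (Icc 0 1) (fun e => e * costDeriv 1 E.cA e + -y) :=
    hE.rent_regularity.add_const _
  refine (h1.sup h2).congr fun e _ => ?_
  simp only [Pi.sup_apply, rent]
  rw [← max_add_add_left]
  congr 1
  ring

theorem strictConvexOn_midpoint_lt {f : ℝ → ℝ} (hf : StrictConvexOn ℝ (Icc 0 1) f) {a b : ℝ}
    (ha : a ∈ Icc (0 : ℝ) 1) (hb : b ∈ Icc (0 : ℝ) 1) (hne : a ≠ b) :
    f ((a + b) / 2) < (f a + f b) / 2 := by
  have := hf.2 ha hb hne (show (0 : ℝ) < 1 / 2 by norm_num) (show (0 : ℝ) < 1 / 2 by norm_num)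
    (by norm_num)
  simp only [smul_eq_mul] at this
  rw [show (a + b) / 2 = 1 / 2 * a + 1 / 2 * b by ring]
  linarith

theorem tradeoff_le (hE : E.Admissible) {k w e p : ℝ} (he : e ≤ 1) (hp : p ∈ Icc (0 : ℝ) 1)
    (h : (k - E.rent e) / w ≤ p) : E.tradeoff k w e ≤ E.cA e + (1 - e) * E.cP p := by
  rw [tradeoff, ← hE.cost_principal.costExt_eq hp]
  have := hE.cost_principal.costExt_mono h
  nlinarith

/-- Two distinct optimal agent efforts are impossible. -/
theorem IsBest.fst_unique (hE : E.Admissible) {l : ℝ → ℝ} (hl : E.IsLossFn l) {y : ℝ}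
    (hy : y ∈ Icc E.xlo E.xhi) {q q' : ℝ × ℝ} (h : E.IsBest l y q) (h' : E.IsBest l y q') :
    q.1 = q'.1 := by
  by_contra hne
  obtain ⟨e, p⟩ := q
  obtain ⟨e', p'⟩ := q'
  simp only at hne
  obtain ⟨⟨he, hp, hc⟩, hbest⟩ := h
  obtain ⟨⟨he', hp', hc'⟩, hbest'⟩ := h'
  simp only at he hp hc he' hp' hc'
  have hval : E.auditCost (l y) y (e, p) = E.auditCost (l y) y (e', p') :=
    le_antisymm (hbest _ ⟨he', hp', hc'⟩) (hbest' _ ⟨he, hp, hc⟩)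
  set em := (e + e') / 2 with hem_def
  have hem : em ∈ Icc (0 : ℝ) 1 := ⟨by linarith [he.1, he'.1], by linarith [he.2, he'.2]⟩
  have hcomp : IsCompact {r | (em, r) ∈ E.auditSet l y} := by
    have : {r | (em, r) ∈ E.auditSet l y} = Prod.snd '' (E.auditSet l y ∩ Prod.fst ⁻¹' {em}) := by
      ext r
      constructor
      · intro hr; exact ⟨(em, r), ⟨hr, rfl⟩, rfl⟩
      · rintro ⟨⟨a, b⟩, ⟨h1, h2⟩, rfl⟩
        simp only [mem_preimage, mem_singleton_iff] at h2
        subst h2; exact h1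
    rw [this]
    exact ((isCompact_auditSet hE l y).inter_right
      (isClosed_singleton.preimage continuous_fst)).image continuous_snd
  -- The competitor is the midpoint agent effort with the least principal effort `pm` consistent
  -- with it.
  obtain ⟨pm, hpm, hleast⟩ := hcomp.exists_isLeast ⟨1, full_audit_mem hE hl hy.1 hem⟩
  have hpmin : pm ∈ Icc (0 : ℝ) 1 := hpm.2.1
  have hbm := hbest _ hpm
  have hA := strictConvexOn_midpoint_lt (strictConvexOn_agentCost hE (l y) y) he he' hne
  have hτ := hE.funds_pos
  have hlo := hE.xlo_nonneg
  have hhi : 0 < E.xhi + E.τ := by linarith [hE.xlo_lt_xhi]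
  simp only [auditCost] at hval hbm
  rw [← hem_def] at hA
  -- If `pm` exceeds neither principal effort, then pairing the higher agent effort with the lower
  -- principal effort, `IsBest.le_of_mem` aside, is not even needed: `pm` undercuts both costs and
  -- strict convexity of the remaining terms contradicts optimality. Otherwise one of the two
  -- efforts, `r < pm`, already meets the first family of constraints, so only the second family can
  -- force `pm` up.
  by_cases hcase : pm ≤ p ∧ pm ≤ p'
  · have h1 : E.cP pm ≤ E.cP p := hE.cost_principal.strict_mono.monotoneOn hpmin hp hcase.1
    have h2 : E.cP pm ≤ E.cP p' := hE.cost_principal.strict_mono.monotoneOn hpmin hp' hcase.2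
    have h3 : (1 - em) * E.cP pm ≤ ((1 - e) * E.cP p + (1 - e') * E.cP p') / 2 := by
      rw [hem_def]
      nlinarith [he.2, he'.2]
    linarith
  · obtain ⟨r, hr, hG, hrlt⟩ : ∃ r ∈ Icc (0 : ℝ) 1,
        (∀ z ∈ Icc y E.xhi, l z ≤ y + r * (z - y)) ∧ r < pm := by
      by_cases h : pm ≤ p
      · exact ⟨p', hp', fun z hz => (hc' z hz).1, by
          by_contra hcon; exact hcase ⟨h, not_lt.1 hcon⟩⟩
      · exact ⟨p, hp, fun z hz => (hc z hz).1, not_le.1 h⟩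
    -- With uniform slack `σ` in the second family, `pm` could be lowered by `σ / (xhi + τ)`. At a
    -- binding type `z`, `tradeoff` is the exact cost of the midpoint and a lower bound at both
    -- optima, so its strict convexity gives the contradiction.
    obtain ⟨z, hz, htouch⟩ : ∃ z ∈ Icc y E.xhi, l y + E.rent em + pm * (z + E.τ) ≤ l z := by
      by_contra hcon
      push Not at hcon
      obtain ⟨σ, hσ, hσle⟩ := exists_pos_forall_le
        (f := fun z => l y + E.rent em + pm * (z + E.τ) - l z)
        (by have := hl.continuous; fun_prop) isCompact_Icc (fun z hz => by linarith [hcon z hz])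
      have hmem : max r (pm - σ / (E.xhi + E.τ)) ∈ {r | (em, r) ∈ E.auditSet l y} := by
        refine ⟨hem, ⟨hr.1.trans (le_max_left _ _), max_le hr.2 ?_⟩, fun z hz => ⟨?_, ?_⟩⟩
        · have := hpmin.2
          have := div_pos hσ hhi
          linarith
        · have h1 := hG z hz
          have h2 : r * (z - y) ≤ max r (pm - σ / (E.xhi + E.τ)) * (z - y) :=
            mul_le_mul_of_nonneg_right (le_max_left _ _) (by linarith [hz.1])
          simp only; linarith
        · have h1 := hσle z hz
          have hz0 : 0 ≤ z + E.τ := by linarith [hz.1, hy.1]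
          have h2 : (pm - σ / (E.xhi + E.τ)) * (z + E.τ) ≤
              max r (pm - σ / (E.xhi + E.τ)) * (z + E.τ) :=
            mul_le_mul_of_nonneg_right (le_max_right _ _) hz0
          have h3 : σ / (E.xhi + E.τ) * (z + E.τ) ≤ σ := by
            rw [div_mul_eq_mul_div, div_le_iff₀ hhi]
            exact mul_le_mul_of_nonneg_left (by linarith [hz.2]) hσ.le
          simp only; linarith
      have := hleast hmem
      have h4 := div_pos hσ hhi
      rcases max_choice r (pm - σ / (E.xhi + E.τ)) with h | h <;> rw [h] at this <;> linarith
    have hw : E.xlo + E.τ ≤ z + E.τ := by linarith [hz.1, hy.1]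
    have hw0 : 0 < z + E.τ := by linarith
    have heq : (l z - l y - E.rent em) / (z + E.τ) = pm := by
      rw [div_eq_iff hw0.ne']
      have := (hpm.2.2 z hz).2
      simp only at this
      linarith
    have hT := strictConvexOn_midpoint_lt (tradeoff_strictConvex hE (l z - l y) hw) he he' hne
    rw [← hem_def] at hT
    have hTe : E.tradeoff (l z - l y) (z + E.τ) e ≤ E.cA e + (1 - e) * E.cP p := by
      refine tradeoff_le hE he.2 hp ?_
      rw [div_le_iff₀ hw0]
      linarith [(hc z hz).2]
    have hTe' : E.tradeoff (l z - l y) (z + E.τ) e' ≤ E.cA e' + (1 - e') * E.cP p' := by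
      refine tradeoff_le hE he'.2 hp' ?_
      rw [div_le_iff₀ hw0]
      linarith [(hc' z hz).2]
    have hTm : E.tradeoff (l z - l y) (z + E.τ) em = E.cA em + (1 - em) * E.cP pm := by
      rw [tradeoff, heq, hE.cost_principal.costExt_eq hpmin]
    have hm : max (-l y) (E.rent em - y) = -l y := by
      refine max_eq_left ?_
      have h1 := hG z hz
      have h2 : r * (z - y) ≤ pm * (z + E.τ) :=
        mul_le_mul hrlt.le (by linarith [hy.1]) (by linarith [hz.1]) hpmin.1
      linarith
    rw [hm] at hbm
    have h1 := le_max_left (-l y) (E.rent e - y)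
    have h2 := le_max_left (-l y) (E.rent e' - y)
    linarith

theorem IsBest.unique (hE : E.Admissible) {l : ℝ → ℝ} (hl : E.IsLossFn l) {y : ℝ}
    (hy : y ∈ Icc E.xlo E.xhi) {q q' : ℝ × ℝ} (h : E.IsBest l y q) (h' : E.IsBest l y q') :
    q = q' := by
  have h1 := h.fst_unique hE hl hy h'
  refine Prod.ext h1 (le_antisymm ?_ ?_)
  · exact h.le_of_mem hE hl hy.1 (h1 ▸ h'.1)
  · exact h'.le_of_mem hE hl hy.1 (h1 ▸ h.1)

/-- Stability of the optimal efforts with respect to the loss function and the type. -/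
theorem IsBest.tendsto (hE : E.Admissible) {ι : Type*} {F : Filter ι} {L : ι → ℝ → ℝ} {l : ℝ → ℝ}
    {Y : ι → ℝ} {y : ℝ} {Q : ι → ℝ × ℝ} {q : ℝ × ℝ} (hL : ∀ i, E.IsLossFn (L i))
    (hl : E.IsLossFn l) (hY : ∀ᶠ i in F, Y i ∈ Icc E.xlo E.xhi) (hy : y ∈ Icc E.xlo E.xhi)
    (hYy : Tendsto Y F (𝓝 y))
    (hLl : ∀ ε > 0, ∀ᶠ i in F, ∀ z ∈ Icc E.xlo E.xhi, |L i z - l z| ≤ ε)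
    (hQ : ∀ᶠ i in F, E.IsBest (L i) (Y i) (Q i)) (hq : E.IsBest l y q)
    (hG : ∀ δ > 0, q.2 + δ < 1 → ∀ᶠ i in F, ∀ z ∈ Icc (Y i) E.xhi,
      L i z ≤ Y i + (q.2 + δ) * (z - Y i)) :
    Tendsto Q F (𝓝 q) := by
  have hlo := hE.xlo_nonneg
  have hτ := hE.funds_pos
  have hLlim : ∀ z ∈ Icc E.xlo E.xhi, Tendsto (fun i => L i z) F (𝓝 (l z)) := by
    intro z hz
    rw [Metric.tendsto_nhds]
    intro ε hε
    filter_upwards [hLl (ε / 2) (by positivity)] with i hi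
    rw [Real.dist_eq]
    linarith [hi z hz]
  have hLY : Tendsto (fun i => L i (Y i)) F (𝓝 (l y)) := by
    rw [Metric.tendsto_nhds]
    intro ε hε
    filter_upwards [hLl (ε / 2) (by positivity), hY,
      ((hl.continuous.tendsto y).comp hYy).eventually (Metric.ball_mem_nhds _ (half_pos hε))]
      with i hi hYi hc
    rw [Real.dist_eq] at hc ⊢
    have := abs_sub_le (L i (Y i)) (l (Y i)) (l y)
    simp only [Function.comp] at hc
    linarith [hi _ hYi]
  -- Raising the principal effort by `δ` gives the second family slack at least `δ * τ`, which
  -- absorbs the perturbation. In the first family the gain `δ * (z - y)` vanishes at `z = y`, hence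
  -- the separate hypothesis `hG`.
  have happrox : ∀ δ > 0, ∀ᶠ i in F, (q.1, min (q.2 + δ) 1) ∈ E.auditSet (L i) (Y i) := by
    intro δ hδ
    rcases lt_or_ge (q.2 + δ) 1 with hlt | hge
    · rw [min_eq_left hlt.le]
      have hδτ : 0 < δ * E.τ := mul_pos hδ hτ
      have hmax : Tendsto (fun i => max (Y i) y - Y i) F (𝓝 0) := by
        have := (hYy.max (tendsto_const_nhds (x := y))).sub hYy
        simpa using this
      filter_upwards [hG δ hδ hlt, hLl (δ * E.τ / 4) (by positivity), hY,
        hLY.eventually (Metric.ball_mem_nhds _ (show 0 < δ * E.τ / 4 by positivity)),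
        hmax.eventually (gt_mem_nhds (show 0 < δ * E.τ / 4 by positivity))] with i hGi hLi hYi h4 h5
      refine ⟨hq.1.1, ⟨by linarith [hq.1.2.1.1], hlt.le⟩, fun z hz => ⟨hGi z hz, ?_⟩⟩
      have h4' : |L i (Y i) - l y| < δ * E.τ / 4 := h4
      rw [abs_lt] at h4'
      have hzlo : E.xlo ≤ z := hYi.1.trans hz.1
      have hp := hq.1.2.1
      have hr := rent_nonneg hE hq.1.1
      have hδz : δ * E.τ ≤ δ * (z + E.τ) := mul_le_mul_of_nonneg_left (by linarith) hδ.le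
      simp only
      -- Types between `Y i` and `y` are outside the limiting constraint, but there the Lipschitz
      -- bound makes the increment of `L i` small.
      rcases le_total y z with hyz | hzy
      · have h6 := (hq.1.2.2 z ⟨hyz, hz.2⟩).2
        have h7 := abs_le.1 (hLi z ⟨hzlo, hz.2⟩)
        linarith [h7.2]
      · have h8 := (hL i).lip (Y i) z hz.1
        have h9 : 0 ≤ q.2 * (z + E.τ) := mul_nonneg hp.1 (by linarith)
        have h10 := le_max_right (Y i) y
        linarith
    · rw [min_eq_right hge]
      filter_upwards [hY] with i hYi
      exact full_audit_mem hE (hL i) hYi.1 hq.1.1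
  -- By compactness it suffices that every cluster point is optimal in the limit problem, since that
  -- problem has a unique solution.
  refine (isCompact_Icc.prod isCompact_Icc : IsCompact (Icc (0 : ℝ) 1 ×ˢ Icc (0 : ℝ) 1))
    |>.tendsto_nhds_of_unique_mapClusterPt
    (hQ.mono fun i h => ⟨h.1.1, h.1.2.1⟩) fun q' hq' hclus => ?_
  obtain ⟨U, hUF, hU⟩ := mapClusterPt_iff_ultrafilter.1 hclus
  refine IsBest.unique hE hl hy ?_ hq
  have hU1 : Tendsto (fun i => (Q i).1) U (𝓝 q'.1) := (continuous_fst.tendsto _).comp hU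
  have hU2 : Tendsto (fun i => (Q i).2) U (𝓝 q'.2) := (continuous_snd.tendsto _).comp hU
  have hUr : Tendsto (fun i => E.rent (Q i).1) U (𝓝 (E.rent q'.1)) := by
    refine (continuousOn_rent hE _ hq'.1).tendsto.comp (tendsto_nhdsWithin_iff.2 ⟨hU1, ?_⟩)
    exact hUF (hQ.mono fun i h => h.1.1)
  have hmem : q' ∈ E.auditSet l y := by
    refine ⟨hq'.1, hq'.2, fun z hz => ?_⟩
    have hzI : z ∈ Icc E.xlo E.xhi := ⟨hy.1.trans hz.1, hz.2⟩
    rcases hz.1.eq_or_lt with rfl | hlt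
    · have h1 := hl.le_self hy.1
      have h2 := rent_nonneg hE hq'.1
      have h3 : 0 ≤ q'.2 * (y + E.τ) := mul_nonneg hq'.2.1 (by linarith [hy.1])
      constructor <;> linarith
    · have hev : ∀ᶠ i in (U : Filter ι), L i z ≤ Y i + (Q i).2 * (z - Y i) ∧
          L i z ≤ L i (Y i) + E.rent (Q i).1 + (Q i).2 * (z + E.τ) := by
        filter_upwards [hUF hQ, hUF (hYy.eventually (gt_mem_nhds hlt))] with i hi hlti
        exact hi.1.2.2 z ⟨le_of_lt hlti, hz.2⟩
      have hYU := hYy.mono_left hUF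
      constructor
      · exact le_of_tendsto_of_tendsto ((hLlim z hzI).mono_left hUF)
          (hYU.add (hU2.mul (hYU.const_sub z))) (hev.mono fun i h => h.1)
      · exact le_of_tendsto_of_tendsto ((hLlim z hzI).mono_left hUF)
          (((hLY.mono_left hUF).add hUr).add (hU2.mul_const _)) (hev.mono fun i h => h.2)
  refine ⟨hmem, fun q'' hq'' => le_trans ?_ (hq.2 q'' hq'')⟩
  have hcost : Tendsto (fun i => E.auditCost (L i (Y i)) (Y i) (Q i)) U
      (𝓝 (E.auditCost (l y) y q')) :=
    tendsto_auditCost hE (hLY.mono_left hUF) (hYy.mono_left hUF) hU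
      (hUF (hQ.mono fun i h => ⟨h.1.1, h.1.2.1⟩)) hq'
  have hbound : ∀ δ > 0, E.auditCost (l y) y q' ≤ E.auditCost (l y) y (q.1, min (q.2 + δ) 1) := by
    intro δ hδ
    have hm : min (q.2 + δ) 1 ∈ Icc (0 : ℝ) 1 :=
      ⟨le_min (by linarith [hq.1.2.1.1]) zero_le_one, min_le_right _ _⟩
    refine le_of_tendsto_of_tendsto hcost (tendsto_auditCost hE (hLY.mono_left hUF)
      (hYy.mono_left hUF) tendsto_const_nhds (Eventually.of_forall fun _ => ⟨hq.1.1, hm⟩)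
      ⟨hq.1.1, hm⟩) ?_
    filter_upwards [hUF hQ, hUF (happrox δ hδ)] with i h1 h2
    exact h1.2 _ h2
  have hlim : Tendsto (fun δ : ℝ => E.auditCost (l y) y (q.1, min (q.2 + δ) 1)) (𝓝[>] 0)
      (𝓝 (E.auditCost (l y) y q)) := by
    refine tendsto_auditCost hE tendsto_const_nhds tendsto_const_nhds ?_ ?_ ⟨hq.1.1, hq.1.2.1⟩
    · have hc : Continuous fun δ : ℝ => (q.1, min (q.2 + δ) 1) := by fun_prop
      have := hc.tendsto 0
      simp only [add_zero, min_eq_left hq.1.2.1.2] at this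
      exact tendsto_nhdsWithin_of_tendsto_nhds this
    · filter_upwards [self_mem_nhdsWithin] with δ hδ
      exact ⟨hq.1.1, le_min (by linarith [hq.1.2.1.1, mem_Ioi.1 hδ]) zero_le_one, min_le_right _ _⟩
  refine ge_of_tendsto hlim ?_
  filter_upwards [self_mem_nhdsWithin] with δ hδ
  exact hbound δ hδ

end PointwiseProblem

/-! ### Translating between mechanisms and loss functions -/

section Implementation

variable {E : Environment}

/-! ### Implementing a loss function -/

/-- The optimal efforts at the advance `y` given the loss function `l`. -/
def bestEfforts (E : Environment) (l : ℝ → ℝ) (y : ℝ) : ℝ × ℝ := Classical.epsilon (E.IsBest l y)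

theorem bestEfforts_spec (hE : E.Admissible) {l : ℝ → ℝ} (hl : E.IsLossFn l) {y : ℝ}
    (hy : E.xlo ≤ y) : E.IsBest l y (E.bestEfforts l y) :=
  Classical.epsilon_spec (exists_isBest hE hl hy)

/-- The expected refund without evidence from the agent that keeps the advance `y` truthful. -/
def impliedRefund (E : Environment) (l : ℝ → ℝ) (y : ℝ) : ℝ :=
  max 0 (y - l y - E.rent (E.bestEfforts l y).1)

/-- The mechanism that implements the loss function `l` with the optimal efforts. -/
def implement (E : Environment) (l : ℝ → ℝ) : TaxMechanism where
  eA y := (E.bestEfforts l y).1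
  eP y := (E.bestEfforts l y).2
  rA y := E.impliedRefund l y + costDeriv 1 E.cA (E.bestEfforts l y).1
  rP y := min (E.impliedRefund l y) ((E.bestEfforts l y).2 * (y + E.τ)) / (E.bestEfforts l y).2
  rN y := max 0 (E.impliedRefund l y - (E.bestEfforts l y).2 * (y + E.τ)) /
    (1 - (E.bestEfforts l y).2)

section Implement

variable {l : ℝ → ℝ} {y : ℝ}

theorem impliedRefund_nonneg : 0 ≤ E.impliedRefund l y := le_max_left _ _

theorem impliedRefund_le (hE : E.Admissible) (hl : E.IsLossFn l) (hy : E.xlo ≤ y) :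
    E.impliedRefund l y ≤ y := by
  have h1 := rent_nonneg hE (bestEfforts_spec hE hl hy).1.1
  have h2 := hl.lo_le hy
  have h3 := hE.xlo_nonneg
  exact max_le (by linarith) (by linarith)

theorem one_sub_mul_implement_rN (hE : E.Admissible) (hl : E.IsLossFn l) (hy : E.xlo ≤ y) :
    (1 - (E.bestEfforts l y).2) * (E.implement l).rN y =
      max 0 (E.impliedRefund l y - (E.bestEfforts l y).2 * (y + E.τ)) := by
  simp only [implement]
  -- When the audit is certain, division by zero sets `rN` to `0`; this is consistent because the
  -- implied refund is at most `y < y + τ`, so nothing is left to pay without evidence.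
  rcases eq_or_ne (1 - (E.bestEfforts l y).2) 0 with h | h
  · have h1 : (E.bestEfforts l y).2 = 1 := by linarith
    have h2 := impliedRefund_le hE hl hy
    have h3 := hE.funds_pos
    rw [h, h1, zero_mul, max_eq_left]
    linarith
  · field_simp

theorem mul_implement_rP :
    (E.bestEfforts l y).2 * (E.implement l).rP y =
      min (E.impliedRefund l y) ((E.bestEfforts l y).2 * (y + E.τ)) := by
  simp only [implement]
  rcases eq_or_ne (E.bestEfforts l y).2 0 with h | h
  · rw [h, zero_mul, zero_mul, min_eq_right impliedRefund_nonneg]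
  · field_simp

theorem implement_refundNoAgent (hE : E.Admissible) (hl : E.IsLossFn l) (hy : E.xlo ≤ y) :
    (E.implement l).refundNoAgent y = E.impliedRefund l y := by
  have h1 := one_sub_mul_implement_rN hE hl hy
  have h2 := mul_implement_rP (E := E) (l := l) (y := y)
  rw [TaxMechanism.refundNoAgent]
  change (E.bestEfforts l y).2 * (E.implement l).rP y +
    (1 - (E.bestEfforts l y).2) * (E.implement l).rN y = _
  rw [h1, h2]
  rcases le_total (E.impliedRefund l y) ((E.bestEfforts l y).2 * (y + E.τ)) with h | h
  · rw [min_eq_left h, max_eq_left (by linarith), add_zero]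
  · rw [min_eq_right h, max_eq_right (by linarith)]; ring

/-- The first branch occurs when the whole implied refund can be paid after an audit, the second
when that refund hits its cap `y + τ` and the remainder is paid without evidence. This explains the
two families in `auditSet`. -/
theorem implement_deviationLoss (hE : E.Admissible) (hl : E.IsLossFn l) (hy : E.xlo ≤ y) (x : ℝ) :
    (E.implement l).deviationLoss y x = min (y + (E.bestEfforts l y).2 * (x - y))
      (l y + E.rent (E.bestEfforts l y).1 + (E.bestEfforts l y).2 * (x + E.τ)) := by
  have h1 := one_sub_mul_implement_rN hE hl hy
  have hp := (bestEfforts_spec hE hl hy).1.2.1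
  have h0 : 0 ≤ (E.bestEfforts l y).2 * (y + E.τ) :=
    mul_nonneg hp.1 (by linarith [hE.xlo_nonneg, hE.funds_pos])
  rw [TaxMechanism.deviationLoss]
  change (E.bestEfforts l y).2 * x + (1 - (E.bestEfforts l y).2) * (y - (E.implement l).rN y) = _
  rw [mul_sub, h1, impliedRefund]
  rcases max_cases 0 (y - l y - E.rent (E.bestEfforts l y).1) with h | h <;> rw [h.1]
  · rw [max_eq_left (by linarith), min_eq_left (by linarith)]; ring
  · rcases le_total (y - l y - E.rent (E.bestEfforts l y).1) ((E.bestEfforts l y).2 * (y + E.τ))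
      with h' | h'
    · rw [max_eq_left (by linarith), min_eq_left (by linarith)]; ring
    · rw [max_eq_right (by linarith), min_eq_right (by linarith)]; ring

theorem implement_evidenceGain (hE : E.Admissible) (hl : E.IsLossFn l) (hy : E.xlo ≤ y) (e : ℝ) :
    E.evidenceGain (E.implement l) y e =
      e * costDeriv 1 E.cA (E.bestEfforts l y).1 - E.cA e := by
  rw [evidenceGain, implement_refundNoAgent hE hl hy]
  simp [implement]

theorem implement_evidenceRent (hE : E.Admissible) (hl : E.IsLossFn l) (hy : E.xlo ≤ y) :
    E.evidenceRent (E.implement l) y = E.rent (E.bestEfforts l y).1 := by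
  rw [evidenceRent, implement_evidenceGain hE hl hy]
  rfl

theorem implement_profit (hE : E.Admissible) (hl : E.IsLossFn l) (hy : E.xlo ≤ y) :
    E.profit (E.implement l) y = -E.auditCost (l y) y (E.bestEfforts l y) := by
  rw [profit, implement_refundNoAgent hE hl hy, implement_evidenceRent hE hl hy, auditCost,
    impliedRefund]
  simp only [implement]
  rcases max_cases 0 (y - l y - E.rent (E.bestEfforts l y).1) with h | h <;> rw [h.1]
  · rw [max_eq_right (by linarith)]; ring
  · rw [max_eq_left (by linarith)]; ring

theorem implement_feasible (hE : E.Admissible) (hl : E.IsLossFn l) :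
    E.Feasible (E.implement l) := by
  intro y hy
  have hb := bestEfforts_spec hE hl hy.1
  have he := hb.1.1
  have hp := hb.1.2.1
  have hτ := hE.funds_pos
  have hy0 : 0 ≤ y := hE.xlo_nonneg.trans hy.1
  have hR0 := impliedRefund_nonneg (E := E) (l := l) (y := y)
  have hR := impliedRefund_le hE hl hy.1
  have hA0 := hE.cost_agent.deriv_nonneg he
  -- The budget assumption `c_A'(1) ≤ τ` makes the reward for the agent's evidence affordable on top
  -- of the implied refund.
  have hA : costDeriv 1 E.cA (E.bestEfforts l y).1 ≤ E.τ :=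
    (hE.cost_agent.deriv_strictMono.monotoneOn he ⟨zero_le_one, le_rfl⟩ he.2).trans hE.budget.1
  refine ⟨he, hp, ⟨add_nonneg hR0 hA0, add_le_add hR hA⟩, ⟨?_, ?_⟩, ?_, ?_⟩
  · exact div_nonneg (le_min hR0 (mul_nonneg hp.1 (by linarith))) hp.1
  · exact div_le_of_le_mul₀ hp.1 (by linarith) ((min_le_right _ _).trans_eq (mul_comm _ _))
  · exact div_nonneg (le_max_left _ _) (by linarith [hp.2])
  · refine div_le_of_le_mul₀ (by linarith [hp.2]) (by linarith) (max_le ?_ ?_)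
    · exact mul_nonneg (by linarith) (by linarith [hp.2])
    · linarith

theorem le_implement_deviationLoss (hE : E.Admissible) (hl : E.IsLossFn l) (hy : E.xlo ≤ y) {x : ℝ}
    (hx : x ∈ Icc y E.xhi) : l x ≤ (E.implement l).deviationLoss y x := by
  rw [implement_deviationLoss hE hl hy]
  exact le_min_iff.2 ((bestEfforts_spec hE hl hy).1.2.2 x hx)

theorem le_implement_loss (hE : E.Admissible) (hl : E.IsLossFn l) {x : ℝ}
    (hx : x ∈ Icc E.xlo E.xhi) : l x ≤ E.loss (E.implement l) x := by
  refine le_csInf ((nonempty_Icc.2 hx.1).image _) ?_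
  rintro _ ⟨y, hy, rfl⟩
  exact le_implement_deviationLoss hE hl hy.1 ⟨hy.2, hx.2⟩

theorem implement_isMechanism (hE : E.Admissible) (hl : E.IsLossFn l) :
    E.IsMechanism (E.implement l) := by
  refine ⟨implement_feasible hE hl, fun x hx => ⟨fun e he => ?_, ?_⟩⟩
  · have hb := (bestEfforts_spec hE hl hx.1).1.1
    have ht := hE.cost_agent.tangent_le hb he
    simp only [mem_ofPred_eq]
    rw [implement_evidenceGain hE hl hx.1, implement_evidenceGain hE hl hx.1]
    simp only [implement]
    linarith
  · have h1 := le_implement_loss hE hl hx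
    rw [utility, implement_refundNoAgent hE hl hx.1, implement_evidenceRent hE hl hx.1,
      impliedRefund]
    have h2 := le_max_right 0 (x - l x - E.rent (E.bestEfforts l x).1)
    linarith

end Implement

/-! ### Losses of feasible mechanisms -/

/-- A real infimum is a lower bound only for sets bounded below; feasibility of the refunds provides
the bound `-τ`. -/
theorem loss_le_deviationLoss (hE : E.Admissible) {m : TaxMechanism} (hm : E.Feasible m) {x y : ℝ}
    (hx : x ≤ E.xhi) (hy : y ∈ Icc E.xlo x) : E.loss m x ≤ m.deviationLoss y x := by
  refine csInf_le ⟨-E.τ, ?_⟩ ⟨y, hy, rfl⟩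
  rintro _ ⟨w, hw, rfl⟩
  obtain ⟨-, hp, -, -, hN⟩ := hm w ⟨hw.1, hw.2.trans hx⟩
  have h0 := hE.xlo_nonneg
  have hτ := hE.funds_pos
  have h1 : 0 ≤ m.eP w * x := mul_nonneg hp.1 (by linarith [hw.1, hw.2])
  have h2 : (1 - m.eP w) * (-E.τ) ≤ (1 - m.eP w) * (w - m.rN w) :=
    mul_le_mul_of_nonneg_left (by linarith [hN.2]) (by linarith [hp.2])
  have h3 : m.eP w * E.τ ≥ 0 := mul_nonneg hp.1 hτ.le
  simp only [TaxMechanism.deviationLoss]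
  linarith

theorem loss_le_self (hE : E.Admissible) {m : TaxMechanism} (hm : E.Feasible m) {x : ℝ}
    (hx : x ∈ Icc E.xlo E.xhi) : E.loss m x ≤ x := by
  refine (loss_le_deviationLoss hE hm hx.2 ⟨hx.1, le_rfl⟩).trans ?_
  obtain ⟨-, hp, -, -, hN⟩ := hm x hx
  have : 0 ≤ (1 - m.eP x) * m.rN x := mul_nonneg (by linarith [hp.2]) hN.1
  simp only [TaxMechanism.deviationLoss]
  linarith

/-! ### The concave hull of a loss function -/

/-- The affine majorants `x ↦ A.2 + A.1 * x` of `f`, with slope in `[0, 1]` and at least the lowest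
type at the lowest type. -/
def majorants (E : Environment) (f : ℝ → ℝ) : Set (ℝ × ℝ) :=
  {A | A.1 ∈ Icc (0 : ℝ) 1 ∧ E.xlo ≤ A.2 + A.1 * E.xlo ∧ ∀ x ∈ Icc E.xlo E.xhi, f x ≤ A.2 + A.1 * x}

/-- The infimum of the affine majorants of `f`. -/
def lossHull (E : Environment) (f : ℝ → ℝ) (x : ℝ) : ℝ :=
  sInf ((fun A : ℝ × ℝ => A.2 + A.1 * x) '' E.majorants f)

section Hull

variable {f : ℝ → ℝ}

theorem lossHull_le {A : ℝ × ℝ} (hA : A ∈ E.majorants f) (x : ℝ) :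
    E.lossHull f x ≤ A.2 + A.1 * x := by
  refine csInf_le ⟨min E.xlo x, ?_⟩ ⟨A, hA, rfl⟩
  rintro _ ⟨B, ⟨hB, hlo, -⟩, rfl⟩
  simp only
  rcases le_total E.xlo x with h | h
  · rw [min_eq_left h]; nlinarith [hB.1]
  · rw [min_eq_right h]; nlinarith [hB.2]

theorem id_mem_majorants (hf : ∀ x ∈ Icc E.xlo E.xhi, f x ≤ x) : ((1 : ℝ), (0 : ℝ)) ∈ E.majorants f :=
  ⟨⟨zero_le_one, le_rfl⟩, by simp, fun x hx => by simpa using hf x hx⟩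

theorem le_lossHull (hf : ∀ x ∈ Icc E.xlo E.xhi, f x ≤ x) {x v : ℝ}
    (h : ∀ A ∈ E.majorants f, v ≤ A.2 + A.1 * x) : v ≤ E.lossHull f x := by
  refine le_csInf ⟨_, _, id_mem_majorants hf, rfl⟩ ?_
  rintro _ ⟨A, hA, rfl⟩
  exact h A hA

theorem self_le_lossHull (hf : ∀ x ∈ Icc E.xlo E.xhi, f x ≤ x) {x : ℝ}
    (hx : x ∈ Icc E.xlo E.xhi) : f x ≤ E.lossHull f x :=
  le_lossHull hf fun _ hA => hA.2.2 x hx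

theorem lossHull_isLossFn (hf : ∀ x ∈ Icc E.xlo E.xhi, f x ≤ x) : E.IsLossFn (E.lossHull f) where
  mono x z hxz := le_lossHull hf fun A hA => (lossHull_le hA x).trans
    (add_le_add le_rfl (mul_le_mul_of_nonneg_left hxz hA.1.1))
  lip x z hxz := by
    have : E.lossHull f z - (z - x) ≤ E.lossHull f x := le_lossHull hf fun A hA => by
      have h1 := lossHull_le hA z
      have h2 : A.1 * (z - x) ≤ 1 * (z - x) := mul_le_mul_of_nonneg_right hA.1.2 (by linarith)
      linarith
    linarith
  at_lo := le_antisymm (by simpa using lossHull_le (id_mem_majorants hf) E.xlo)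
    (le_lossHull hf fun A hA => hA.2.1)

theorem lossHull_concave (hf : ∀ x ∈ Icc E.xlo E.xhi, f x ≤ x) :
    ConcaveOn ℝ univ (E.lossHull f) := by
  refine ⟨convex_univ, fun x _ z _ a b ha hb hab => le_lossHull hf fun A hA => ?_⟩
  have h1 := mul_le_mul_of_nonneg_left (lossHull_le hA x) ha
  have h2 := mul_le_mul_of_nonneg_left (lossHull_le hA z) hb
  simp only [smul_eq_mul]
  have h3 : A.2 = (a + b) * A.2 := by rw [hab, one_mul]
  nlinarith

end Hull

/-- With full effort, the evidence rent of an obedient type is at least the rent of full effort. -/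
theorem rent_one_le_evidenceRent (hE : E.Admissible) {m : TaxMechanism} {x : ℝ}
    (h : E.Obedient m x) (h1 : m.eA x = 1) : E.rent 1 ≤ E.evidenceRent m x := by
  have hc := hE.cost_agent
  have hmem : (1 : ℝ) ∈ Icc (0 : ℝ) 1 := ⟨zero_le_one, le_rfl⟩
  have hcont := (hc.continuousOn_costDeriv (k := 1) (by norm_num)) 1 hmem
  have hle : 𝓝[Ico (0 : ℝ) 1] 1 ≤ 𝓝[Icc (0 : ℝ) 1] 1 := nhdsWithin_mono _ Ico_subset_Icc_self
  have hne : (𝓝[Ico (0 : ℝ) 1] (1 : ℝ)).NeBot := by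
    rw [nhdsWithin_Ico_eq_nhdsLT zero_lt_one]; infer_instance
  have hd : costDeriv 1 E.cA 1 ≤ m.rA x - m.refundNoAgent x := by
    refine le_of_tendsto (hcont.tendsto.mono_left hle) ?_
    filter_upwards [self_mem_nhdsWithin] with e he
    have h2 := h (Ico_subset_Icc_self he)
    simp only [mem_ofPred_eq, evidenceGain, h1] at h2
    have h3 := hc.tangent_le (Ico_subset_Icc_self he) hmem
    have h4 : costDeriv 1 E.cA e * (1 - e) ≤ (m.rA x - m.refundNoAgent x) * (1 - e) := by linarith
    exact le_of_mul_le_mul_right h4 (by linarith [he.2])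
  simp only [rent, evidenceRent, evidenceGain, h1]
  linarith

/-- The efforts of a mechanism are consistent with the hull of its loss function. -/
theorem exists_mem_auditSet_lossHull (hE : E.Admissible) {m : TaxMechanism} (hm : E.IsMechanism m)
    {y : ℝ} (hy : y ∈ Icc E.xlo E.xhi) :
    ∃ q ∈ E.auditSet (E.lossHull (E.loss m)) y,
      E.profit m y ≤ -E.auditCost (E.lossHull (E.loss m) y) y q ∧
        (q = (m.eA y, m.eP y) ∨ q.1 = 1) := by
  obtain ⟨hfeas, hic⟩ := hm
  have hself : ∀ x ∈ Icc E.xlo E.xhi, E.loss m x ≤ x := fun x hx => loss_le_self hE hfeas hx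
  set H := E.lossHull (E.loss m) with hH
  have hHl : E.IsLossFn H := lossHull_isLossFn hself
  obtain ⟨he, hp, hrA, hrP, hrN⟩ := hfeas y hy
  obtain ⟨hob, hu⟩ := hic y hy
  have hloss : E.loss m y ≤ H y := self_le_lossHull hself hy
  have hτ := hE.funds_pos
  have hR : 0 ≤ m.refundNoAgent y :=
    add_nonneg (mul_nonneg hp.1 hrP.1) (mul_nonneg (by linarith [hp.2]) hrN.1)
  rw [utility] at hu
  rcases he.2.eq_or_lt with h1 | hlt
  · refine ⟨(1, 1), full_audit_mem hE hHl hy.1 ⟨zero_le_one, le_rfl⟩, ?_, Or.inr rfl⟩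
    have h2 := rent_one_le_evidenceRent hE hob h1
    have h3 : max (-H y) (E.rent 1 - y) ≤ m.refundNoAgent y + E.evidenceRent m y - y :=
      max_le (by linarith) (by linarith)
    simp only [profit, auditCost, h1, sub_self, zero_mul]
    linarith
  · have hrent := evidenceRent_eq_rent hE.cost_agent hob he.1 hlt
    rw [hrent] at hu
    refine ⟨(m.eA y, m.eP y), ⟨he, hp, fun z hz => ⟨?_, ?_⟩⟩, ?_, Or.inl rfl⟩
    · have hB : (m.eP y, (1 - m.eP y) * y) ∈ E.majorants (E.loss m) := by
        refine ⟨hp, ?_, fun x hx => ?_⟩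
        · simp only; nlinarith [hp.2, hy.1]
        · simp only
          rcases le_total y x with h | h
          · refine (loss_le_deviationLoss hE hfeas hx.2 ⟨hy.1, h⟩).trans ?_
            have : 0 ≤ (1 - m.eP y) * m.rN y := mul_nonneg (by linarith [hp.2]) hrN.1
            simp only [TaxMechanism.deviationLoss]
            linarith
          · have := hself x hx
            nlinarith [hp.2]
      have := lossHull_le hB z
      simp only at this ⊢
      linarith
    · refine le_of_forall_pos_le_add fun ε hε => ?_
      have hex : ∃ A ∈ E.majorants (E.loss m), A.2 + A.1 * y < H y + ε := by
        obtain ⟨_, ⟨A, hA, rfl⟩, hlt⟩ := exists_lt_of_csInf_lt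
          (s := (fun A : ℝ × ℝ => A.2 + A.1 * y) '' E.majorants (E.loss m))
          ⟨_, _, id_mem_majorants hself, rfl⟩ (show _ < H y + ε by
            change H y < H y + ε
            linarith)
        exact ⟨A, hA, hlt⟩
      obtain ⟨A, hA, hAy⟩ := hex
      have hrr := rent_nonneg hE he
      have hpy : 0 ≤ m.eP y * (y + E.τ) := mul_nonneg hp.1 (by linarith [hy.1, hE.xlo_nonneg])
      simp only
      by_cases hcase : A.2 + A.1 * z ≤ H y + E.rent (m.eA y) + m.eP y * (z + E.τ) + ε
      · exact (lossHull_le hA z).trans hcase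
      · push Not at hcase
        -- The majorant `A` is nearly tight at `y` but too high at `z`, so it is steeper than the
        -- wanted line. That line then dominates `A` left of `y`, and incentive compatibility makes
        -- it dominate the loss right of `y`; hence it is a majorant.
        have hslope : m.eP y < A.1 := by
          have : m.eP y * (z - y) < A.1 * (z - y) := by linarith
          exact lt_of_mul_lt_mul_right this (by linarith [hz.1])
        have hdom : ∀ x ≤ y, A.2 + A.1 * x ≤
            (H y + E.rent (m.eA y) + m.eP y * E.τ + ε) + m.eP y * x := by
          intro x hx
          have : m.eP y * (y - x) ≤ A.1 * (y - x) :=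
            mul_le_mul_of_nonneg_right hslope.le (by linarith)
          linarith
        have hC : (m.eP y, H y + E.rent (m.eA y) + m.eP y * E.τ + ε) ∈
            E.majorants (E.loss m) := by
          refine ⟨hp, hA.2.1.trans (hdom _ hy.1), fun x hx => ?_⟩
          rcases le_total x y with h | h
          · exact (hA.2.2 x hx).trans (hdom x h)
          · refine (loss_le_deviationLoss hE hfeas hx.2 ⟨hy.1, h⟩).trans ?_
            have h1 : m.eP y * m.rP y ≤ m.eP y * (y + E.τ) :=
              mul_le_mul_of_nonneg_left hrP.2 hp.1
            simp only [TaxMechanism.deviationLoss]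
            simp only [TaxMechanism.refundNoAgent] at hu
            linarith
        have := lossHull_le hC z
        simp only at this
        linarith
    · have h3 : max (-H y) (E.rent (m.eA y) - y) ≤
          m.refundNoAgent y + E.rent (m.eA y) - y := max_le (by linarith) (by linarith)
      simp only [profit, auditCost, hrent]
      linarith

/-- The efforts and the profit of a tight mechanism are optimal given the hull of its loss
function. -/
theorem IsTight.isBest (hE : E.Admissible) {m : TaxMechanism} (hm : E.IsTight m) {y : ℝ}
    (hy : y ∈ Icc E.xlo E.xhi) :
    E.IsBest (E.lossHull (E.loss m)) y (m.eA y, m.eP y) ∧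
      E.profit m y = -E.auditCost (E.lossHull (E.loss m) y) y (m.eA y, m.eP y) := by
  obtain ⟨hmech, htight⟩ := hm
  have hself : ∀ x ∈ Icc E.xlo E.xhi, E.loss m x ≤ x := fun x hx => loss_le_self hE hmech.1 hx
  set H := E.lossHull (E.loss m) with hH
  have hHl : E.IsLossFn H := lossHull_isLossFn hself
  -- Implementing the hull is tighter than `m`, so tightness makes `m` at least as profitable, which
  -- forces its efforts to attain the minimum.
  have hT := htight (E.implement H) (implement_isMechanism hE hHl) (fun x hx => by
    obtain ⟨q, hq, hle, -⟩ := exists_mem_auditSet_lossHull hE hmech hx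
    refine ⟨?_, (self_le_lossHull hself hx).trans (le_implement_loss hE hHl hx)⟩
    rw [implement_profit hE hHl hx.1]
    have := (bestEfforts_spec hE hHl hx.1).2 q hq
    linarith)
  obtain ⟨q, hq, hle, hor⟩ := exists_mem_auditSet_lossHull hE hmech hy
  have h1 := (hT y hy).1
  rw [implement_profit hE hHl hy.1] at h1
  have hb := bestEfforts_spec hE hHl hy.1
  have h2 := hb.2 q hq
  have hbest : E.IsBest H y q := ⟨hq, fun q' hq' => by linarith [hb.2 q' hq']⟩
  have hq1 := hbest.lt_one hE hHl hy.1
  rcases hor with rfl | h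
  · exact ⟨hbest, by linarith⟩
  · exact absurd h hq1.ne

end Implementation

/-! ### Smooth loss functions: touching lines and first-order conditions -/

section SmoothLoss

variable {E : Environment}

/-- A continuously differentiable concave loss function with derivative `g` that is affine up to the
type `c` and strictly concave from there on. -/
structure IsSmoothLoss (E : Environment) (l g : ℝ → ℝ) (c : ℝ) : Prop where
  hasDerivAt : ∀ x, HasDerivAt l (g x) x
  anti : Antitone g
  pos : ∀ x, 0 < g x
  lt_one : ∀ x, g x < 1
  mem : c ∈ Ioo E.xlo E.xhi
  const : ∀ x ≤ c, g x = g E.xlo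
  strictAnti : StrictAntiOn g (Ici c)
  at_lo : l E.xlo = E.xlo

namespace IsSmoothLoss

variable {l g : ℝ → ℝ} {c : ℝ}

theorem strictMono (hs : E.IsSmoothLoss l g c) : StrictMono l :=
  strictMono_of_hasDerivAt_pos hs.hasDerivAt hs.pos

theorem strictMono_sub (hs : E.IsSmoothLoss l g c) : StrictMono fun x => x - l x :=
  strictMono_of_hasDerivAt_pos (f' := fun x => 1 - g x)
    (fun x => (hasDerivAt_id x).sub (hs.hasDerivAt x)) fun x => by linarith [hs.lt_one x]

theorem isLossFn (hs : E.IsSmoothLoss l g c) : E.IsLossFn l where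
  mono := hs.strictMono.monotone
  lip x z hxz := by
    have := hs.strictMono_sub.monotone hxz
    linarith
  at_lo := hs.at_lo

theorem lt_self (hs : E.IsSmoothLoss l g c) {x : ℝ} (hx : E.xlo < x) : l x < x := by
  have := hs.strictMono_sub hx
  simp only [hs.at_lo] at this
  linarith

theorem exists_slope (hs : E.IsSmoothLoss l g c) {x z : ℝ} (h : x < z) :
    ∃ t ∈ Ioo x z, l z - l x = g t * (z - x) := by
  obtain ⟨t, ht, heq⟩ := exists_hasDerivAt_eq_slope l g h
    (fun u _ => (hs.hasDerivAt u).continuousAt.continuousWithinAt) (fun u _ => hs.hasDerivAt u)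
  refine ⟨t, ht, ?_⟩
  rw [heq, div_mul_cancel₀ _ (by linarith)]

theorem tangent_le (hs : E.IsSmoothLoss l g c) (x z : ℝ) : l z ≤ l x + g x * (z - x) := by
  rcases lt_trichotomy x z with h | rfl | h
  · obtain ⟨t, ht, heq⟩ := hs.exists_slope h
    nlinarith [hs.anti ht.1.le]
  · simp
  · obtain ⟨t, ht, heq⟩ := hs.exists_slope h
    nlinarith [hs.anti ht.2.le]

theorem slope_lt (hs : E.IsSmoothLoss l g c) {x z : ℝ} (hx : c < x) (hz : z < x) :
    g x < g z := by
  rcases le_total c z with h | h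
  · exact hs.strictAnti h hx.le hz
  · rw [hs.const z h, ← hs.const c le_rfl]
    exact hs.strictAnti self_mem_Ici hx.le hx

theorem tangent_lt (hs : E.IsSmoothLoss l g c) {x z : ℝ} (hx : c < x) (hne : z ≠ x) :
    l z < l x + g x * (z - x) := by
  rcases hne.lt_or_gt with h | h
  · obtain ⟨t, ht, heq⟩ := hs.exists_slope h
    nlinarith [hs.slope_lt hx ht.2]
  · obtain ⟨t, ht, heq⟩ := hs.exists_slope h
    nlinarith [hs.slope_lt (hx.trans ht.1) ht.1]

theorem eq_of_le (hs : E.IsSmoothLoss l g c) {x : ℝ} (h0 : E.xlo ≤ x) (hx : x ≤ c) :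
    l x = E.xlo + g E.xlo * (x - E.xlo) := by
  rcases h0.eq_or_lt with rfl | h
  · simp [hs.at_lo]
  · obtain ⟨t, ht, heq⟩ := hs.exists_slope h
    rw [hs.const t (ht.2.le.trans hx), hs.at_lo] at heq
    linarith

/-- A line that lies above `l` on `[y, xhi]` and touches it right of `y` lies above `l`
everywhere to the left of `xhi`. -/
theorem line_le (hs : E.IsSmoothLoss l g c) {v p y z : ℝ}
    (hline : ∀ x ∈ Icc y E.xhi, l x ≤ v + p * x) (hz : z ∈ Ioc y E.xhi) (htouch : l z = v + p * z)
    {x : ℝ} (hx : x ≤ E.xhi) : l x ≤ v + p * x := by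
  rcases le_or_gt y x with h | h
  · exact hline x ⟨h, hx⟩
  · obtain ⟨w, hw⟩ := exists_between hz.1
    obtain ⟨t, ht, heq⟩ := hs.exists_slope hw.2
    have h1 := hline w ⟨hw.1.le, hw.2.le.trans hz.2⟩
    have h2 := hline t ⟨(hw.1.trans ht.1).le, ht.2.le.trans hz.2⟩
    have h3 : p ≤ g t := by
      have : p * (z - w) ≤ g t * (z - w) := by linarith
      exact le_of_mul_le_mul_right this (by linarith [hw.2])
    have h4 := hs.tangent_le t x
    have h5 : x < t := h.trans (hw.1.trans ht.1)
    nlinarith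

/-- A line above `l` that does not start at the lowest type touches `l` at most once. -/
theorem touch_unique (hs : E.IsSmoothLoss l g c) {v p z₁ z₂ : ℝ} (hv : v + p * E.xlo ≠ E.xlo)
    (h0 : E.xlo ≤ z₁) (hlt : z₁ < z₂) (hline : ∀ x ∈ Icc z₁ z₂, l x ≤ v + p * x)
    (h₁ : l z₁ = v + p * z₁) (h₂ : l z₂ = v + p * z₂) : False := by
  -- Two touches on the affine piece would make the line extend that piece through the point `(xlo,
  -- xlo)`, which `hv` excludes. Otherwise a point between the touches lies on the strictly concave
  -- part, where `l` would exceed the chord.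
  rcases le_or_gt z₂ c with h | h
  · rw [hs.eq_of_le h0 (hlt.le.trans h)] at h₁
    rw [hs.eq_of_le (h0.trans hlt.le) h] at h₂
    have : (g E.xlo - p) * (z₂ - z₁) = 0 := by linarith
    rcases mul_eq_zero.1 this with h' | h'
    · apply hv
      have : p = g E.xlo := by linarith
      rw [this] at h₁ ⊢
      linarith
    · linarith
  · obtain ⟨w, hw1, hw2⟩ := exists_between (max_lt hlt h)
    have hwz : z₁ < w := (le_max_left _ _).trans_lt hw1
    have hwc : c < w := (le_max_right _ _).trans_lt hw1
    have t1 := hs.tangent_lt hwc hwz.ne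
    have t2 := hs.tangent_lt hwc hw2.ne'
    have t3 := hline w ⟨hwz.le, hw2.le⟩
    have e1 : (z₂ - w) * l z₁ < (z₂ - w) * (l w + g w * (z₁ - w)) :=
      mul_lt_mul_of_pos_left t1 (by linarith)
    have e2 : (w - z₁) * l z₂ < (w - z₁) * (l w + g w * (z₂ - w)) :=
      mul_lt_mul_of_pos_left t2 (by linarith)
    have e3 : (z₂ - z₁) * l w ≤ (z₂ - z₁) * (v + p * w) :=
      mul_le_mul_of_nonneg_left t3 (by linarith)
    rw [h₁] at e1
    rw [h₂] at e2
    nlinarith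

end IsSmoothLoss

/-- The expected loss from advancing `y` under the mechanism with the efforts `q`. -/
def auditLine (E : Environment) (v y : ℝ) (q : ℝ × ℝ) (x : ℝ) : ℝ :=
  min (y + q.2 * (x - y)) (v + E.rent q.1 + q.2 * (x + E.τ))

theorem auditLine_eq (v y : ℝ) (q : ℝ × ℝ) (x : ℝ) :
    E.auditLine v y q x = E.auditLine v y q 0 + q.2 * x := by
  rw [auditLine, auditLine, ← min_add_add_right]
  congr 1 <;> ring

theorem le_auditLine {l : ℝ → ℝ} {y : ℝ} {q : ℝ × ℝ} (h : q ∈ E.auditSet l y) {z : ℝ}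
    (hz : z ∈ Icc y E.xhi) : l z ≤ E.auditLine (l y) y q z :=
  le_min_iff.2 (h.2.2 z hz)

theorem lo_lt_auditLine (hE : E.Admissible) {l : ℝ → ℝ} (hl : E.IsLossFn l) {y : ℝ} {q : ℝ × ℝ}
    (hq : q ∈ E.auditSet l y) (hy : E.xlo < y) (h0 : 0 < q.2) (h1 : q.2 < 1) :
    E.xlo < E.auditLine (l y) y q E.xlo := by
  have h2 := rent_nonneg hE hq.1
  have h3 := hl.lo_le hy.le
  have h4 := mul_pos h0 (xlo_add_τ_pos hE)
  refine lt_min ?_ ?_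
  · nlinarith
  · linarith

namespace IsBest

variable {l : ℝ → ℝ} {y : ℝ} {q : ℝ × ℝ}

/-- If the line stayed strictly above `l`, by at least `σ`, a positive principal effort could be
reduced at no loss in deterrence. -/
theorem exists_touch (hE : E.Admissible) (hl : E.IsLossFn l) (hy : y ∈ Icc E.xlo E.xhi)
    (h : E.IsBest l y q) (hp : 0 < q.2) : ∃ z ∈ Icc y E.xhi, l z = E.auditLine (l y) y q z := by
  by_contra hcon
  push Not at hcon
  have hhi : 0 < E.xhi + E.τ := by linarith [xlo_add_τ_pos hE, hE.xlo_lt_xhi]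
  have hlo := hE.xlo_nonneg
  have hτ := hE.funds_pos
  obtain ⟨σ, hσ, hσle⟩ := exists_pos_forall_le (f := fun z => E.auditLine (l y) y q z - l z)
    (by have := hl.continuous; unfold auditLine; fun_prop) isCompact_Icc
    (fun z hz => by
      have := lt_of_le_of_ne (le_auditLine h.1 hz) (hcon z hz)
      linarith)
  have hd := div_pos hσ hhi
  have hmem : (q.1, max 0 (q.2 - σ / (E.xhi + E.τ))) ∈ E.auditSet l y := by
    refine ⟨h.1.1, ⟨le_max_left _ _, max_le zero_le_one (by linarith [h.1.2.1.2])⟩,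
      fun z hz => ?_⟩
    have h1 := hσle z hz
    have hz0 : 0 ≤ z + E.τ := by linarith [hz.1, hy.1]
    have h2 := min_le_left (y + q.2 * (z - y)) (l y + E.rent q.1 + q.2 * (z + E.τ))
    have h3 := min_le_right (y + q.2 * (z - y)) (l y + E.rent q.1 + q.2 * (z + E.τ))
    have h4 : ∀ u, 0 ≤ u → u ≤ E.xhi + E.τ →
        q.2 * u - σ ≤ max 0 (q.2 - σ / (E.xhi + E.τ)) * u := by
      intro u hu hu'
      have h5 : (q.2 - σ / (E.xhi + E.τ)) * u ≤ max 0 (q.2 - σ / (E.xhi + E.τ)) * u :=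
        mul_le_mul_of_nonneg_right (le_max_right _ _) hu
      have h6 : σ / (E.xhi + E.τ) * u ≤ σ := by
        rw [div_mul_eq_mul_div, div_le_iff₀ hhi]
        exact mul_le_mul_of_nonneg_left hu' hσ.le
      linarith
    have h7 := h4 (z - y) (by linarith [hz.1]) (by linarith [hz.2, hy.1])
    have h8 := h4 (z + E.τ) hz0 (by linarith [hz.2])
    simp only [auditLine] at h1
    constructor <;> simp only <;> linarith
  have := h.le_of_mem hE hl hy.1 hmem
  rcases max_choice 0 (q.2 - σ / (E.xhi + E.τ)) with h' | h' <;> rw [h'] at this <;> linarith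

/-- First-order condition for decreases of the agent effort that are compensated by the
principal. -/
theorem foc_left (hE : E.Admissible) (hl : E.IsLossFn l) (hy : E.xlo ≤ y) (h : E.IsBest l y q)
    (he : 0 < q.1) {w : ℝ} (hw : 0 < w)
    (hev : ∀ᶠ e in 𝓝[<] q.1, (e, (E.rent q.1 + q.2 * w - E.rent e) / w) ∈ E.auditSet l y) :
    costDeriv 1 E.cA q.1 - E.cP q.2 -
      costExtDeriv E.cP q.2 / w * ((1 - q.1) * (q.1 * costDeriv 2 E.cA q.1)) ≤ 0 := by
  have heI : q.1 ∈ Ioo (0 : ℝ) 1 := ⟨he, h.lt_one hE hl hy⟩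
  have hq2 : (E.rent q.1 + q.2 * w - E.rent q.1) / w = q.2 := by field_simp; ring
  have hcq := hE.cost_principal.costExt_eq h.1.2.1
  have hd := hasDerivAt_tradeoff hE (E.rent q.1 + q.2 * w) w heI
  rw [hq2, hcq] at hd
  refine hasDerivAt_nonpos_of_eventually_left hd ?_
  filter_upwards [hev, self_mem_nhdsWithin] with e hmem hlt
  have h1 := h.2 _ hmem
  have h2 := (rent_strictMono hE).monotoneOn hmem.1 h.1.1 (le_of_lt hlt)
  have h3 : max (-l y) (E.rent e - y) ≤ max (-l y) (E.rent q.1 - y) :=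
    max_le_max le_rfl (by linarith)
  simp only [auditCost] at h1
  rw [tradeoff, tradeoff, hq2, hcq, hE.cost_principal.costExt_eq hmem.2.1]
  linarith

/-- First-order condition for increases of the agent effort that save effort of the principal. -/
theorem foc_right (hE : E.Admissible) (hl : E.IsLossFn l) (hy : E.xlo ≤ y) (h : E.IsBest l y q)
    (he : 0 < q.1) {w : ℝ} (hw : 0 < w)
    (hev : ∀ᶠ e in 𝓝[>] q.1, (e, (E.rent q.1 + q.2 * w - E.rent e) / w) ∈ E.auditSet l y ∧
      E.rent e - y ≤ -l y) :
    0 ≤ costDeriv 1 E.cA q.1 - E.cP q.2 -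
      costExtDeriv E.cP q.2 / w * ((1 - q.1) * (q.1 * costDeriv 2 E.cA q.1)) := by
  have heI : q.1 ∈ Ioo (0 : ℝ) 1 := ⟨he, h.lt_one hE hl hy⟩
  have hq2 : (E.rent q.1 + q.2 * w - E.rent q.1) / w = q.2 := by field_simp; ring
  have hcq := hE.cost_principal.costExt_eq h.1.2.1
  have hd := hasDerivAt_tradeoff hE (E.rent q.1 + q.2 * w) w heI
  rw [hq2, hcq] at hd
  refine hasDerivAt_nonneg_of_eventually_right hd ?_
  filter_upwards [hev] with e hmem
  have h1 := h.2 _ hmem.1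
  have h3 := le_max_left (-l y) (E.rent q.1 - y)
  simp only [auditCost] at h1
  rw [max_eq_left hmem.2] at h1
  rw [tradeoff, tradeoff, hq2, hcq, hE.cost_principal.costExt_eq hmem.1.2.1]
  linarith

/-- The first bit of agent effort is free at the margin because `c_A'(0) = 0`, while it saves a
share of the positive audit cost. While the rent stays below `y - l y`, it only replaces refund and
costs nothing. -/
theorem fst_pos (hE : E.Admissible) (h : E.IsBest l y q) (hly : l y < y) (hp : 0 < q.2) :
    0 < q.1 := by
  refine lt_of_le_of_ne h.1.1.1 fun heq => ?_
  have hc := hE.cost_agent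
  have h0 : (0 : ℝ) ∈ Icc (0 : ℝ) 1 := ⟨le_rfl, zero_le_one⟩
  have hcP : 0 < E.cP q.2 := by
    rw [← hE.cost_principal.zero]
    exact hE.cost_principal.strict_mono h0 h.1.2.1 hp
  have hle : 𝓝[Ioc (0 : ℝ) 1] 0 ≤ 𝓝[Icc (0 : ℝ) 1] 0 := nhdsWithin_mono _ Ioc_subset_Icc_self
  have hne : (𝓝[Ioc (0 : ℝ) 1] (0 : ℝ)).NeBot := by
    rw [nhdsWithin_Ioc_eq_nhdsGT zero_lt_one]; infer_instance
  have hlim := ((hc.continuousOn_costDeriv (k := 1) (by norm_num)) 0 h0).tendsto.mono_left hle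
  have hrent := ((continuousOn_rent hE) 0 h0).tendsto.mono_left hle
  rw [rent_zero hE] at hrent
  have : E.cP q.2 ≤ costDeriv 1 E.cA 0 := by
    refine ge_of_tendsto hlim ?_
    filter_upwards [self_mem_nhdsWithin,
      hrent.eventually (gt_mem_nhds (show 0 < y - l y by linarith))] with e he hr
    have he' := Ioc_subset_Icc_self he
    have hmem : (e, q.2) ∈ E.auditSet l y := by
      refine ⟨he', h.1.2.1, fun z hz => ⟨(h.1.2.2 z hz).1, ?_⟩⟩
      have h1 := (h.1.2.2 z hz).2
      rw [← heq, rent_zero hE] at h1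
      have h2 := rent_nonneg hE he'
      simp only
      linarith
    have h1 := h.2 _ hmem
    have h2 := le_max_left (-l y) (E.rent q.1 - y)
    simp only [auditCost] at h1
    rw [max_eq_left (show E.rent e - y ≤ -l y by linarith)] at h1
    rw [← heq] at h1 h2
    rw [hc.zero] at h1
    have h3 := hc.tangent_le he' h0
    rw [hc.zero] at h3
    have h4 : E.cP q.2 * e ≤ costDeriv 1 E.cA e * e := by linarith
    exact le_of_mul_le_mul_right h4 he.1
  rw [hc.deriv_zero] at this
  linarith

variable {g : ℝ → ℝ} {c : ℝ}

/-- Without audits, deterring type `xhi` requires a positive rent, hence positive agent effort.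
Replacing a bit of it by principal effort then pays, since `c_P(0) = c_P'(0) = 0`; the exchange rate
`τ` works for all types. -/
theorem snd_pos (hE : E.Admissible) (hs : E.IsSmoothLoss l g c) (hy : y ∈ Ico E.xlo E.xhi)
    (h : E.IsBest l y q) : 0 < q.2 := by
  refine lt_of_le_of_ne h.1.2.1.1 fun heq => ?_
  have hτ := hE.funds_pos
  have hlo := hE.xlo_nonneg
  have hl := hs.isLossFn
  have hb := h.1.2.2 E.xhi ⟨hy.2.le, le_rfl⟩
  rw [← heq] at hb
  have hlt := hs.strictMono hy.2
  have he : 0 < q.1 := by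
    refine lt_of_le_of_ne h.1.1.1 fun h0 => ?_
    rw [← h0, rent_zero hE] at hb
    linarith [hb.2]
  have heI : q.1 ∈ Ioo (0 : ℝ) 1 := ⟨he, h.lt_one hE hl hy.1⟩
  have hcont : Tendsto E.rent (𝓝[<] q.1) (𝓝 (E.rent q.1)) :=
    (hasDerivAt_rent hE heI).continuousAt.tendsto.mono_left nhdsWithin_le_nhds
  have hfoc := h.foc_left hE hl hy.1 he hτ (by
    filter_upwards [self_mem_nhdsWithin, nhdsWithin_le_nhds (lt_mem_nhds he),
      hcont.eventually (lt_mem_nhds (show E.rent q.1 - E.τ < E.rent q.1 by linarith))]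
      with e hlt hpos hr
    have heI' : e ∈ Icc (0 : ℝ) 1 := ⟨le_of_lt hpos, (le_of_lt hlt).trans h.1.1.2⟩
    have h1 := (rent_strictMono hE).monotoneOn heI' h.1.1 (le_of_lt hlt)
    have hp0 : 0 ≤ (E.rent q.1 + q.2 * E.τ - E.rent e) / E.τ := by
      rw [← heq]; exact div_nonneg (by linarith) hτ.le
    have hpτ : (E.rent q.1 + q.2 * E.τ - E.rent e) / E.τ * E.τ = E.rent q.1 - E.rent e := by
      rw [← heq]; field_simp; ring
    refine ⟨heI', ⟨hp0, ?_⟩, fun z hz => ?_⟩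
    · rw [← heq, div_le_one hτ]; linarith
    · have h2 := h.1.2.2 z hz
      rw [← heq] at h2
      have hz0 : 0 ≤ z := hlo.trans (hy.1.trans hz.1)
      have h3 := mul_nonneg hp0 (sub_nonneg.2 hz.1)
      have h4 := mul_nonneg hp0 hz0
      simp only
      constructor <;> linarith [h2.1, h2.2])
  rw [← heq, hE.cost_principal.zero, hE.cost_principal.costExtDeriv_of_nonpos le_rfl] at hfoc
  have := hE.cost_agent.deriv_strictMono ⟨le_rfl, zero_le_one⟩ h.1.1 he
  rw [hE.cost_agent.deriv_zero] at this
  simp only [zero_div, zero_mul] at hfoc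
  linarith

/-- Concavity makes the initial slope of `l` sufficient, and the affine initial piece makes it
necessary. -/
theorem snd_at_lo (hE : E.Admissible) (hs : E.IsSmoothLoss l g c) (h : E.IsBest l E.xlo q) :
    q.2 = g E.xlo := by
  refine le_antisymm (h.le_of_mem hE hs.isLossFn le_rfl ?_) ?_
  · refine ⟨h.1.1, ⟨(hs.pos _).le, (hs.lt_one _).le⟩, fun z hz => ?_⟩
    have h1 := hs.tangent_le E.xlo z
    have h2 := rent_nonneg hE h.1.1
    have h3 := mul_pos (hs.pos E.xlo) (xlo_add_τ_pos hE)
    rw [hs.at_lo] at h1 ⊢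
    simp only
    constructor <;> linarith
  · have h1 := (h.1.2.2 c ⟨hs.mem.1.le, hs.mem.2.le⟩).1
    rw [hs.eq_of_le hs.mem.1.le le_rfl] at h1
    have h2 : g E.xlo * (c - E.xlo) ≤ q.2 * (c - E.xlo) := by linarith
    exact le_of_mul_le_mul_right h2 (by linarith [hs.mem.1])

theorem snd_at_hi (hE : E.Admissible) (hs : E.IsSmoothLoss l g c) (h : E.IsBest l E.xhi q) :
    q.2 = 0 := by
  have hlt := hE.xlo_lt_xhi
  refine le_antisymm (h.le_of_mem hE hs.isLossFn hlt.le ?_) h.1.2.1.1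
  refine ⟨h.1.1, ⟨le_rfl, zero_le_one⟩, fun z hz => ?_⟩
  obtain rfl : z = E.xhi := le_antisymm hz.2 hz.1
  have h1 := hs.lt_self hlt
  have h2 := rent_nonneg hE h.1.1
  simp only
  constructor <;> linarith

theorem touch_gt (hE : E.Admissible) (hs : E.IsSmoothLoss l g c) (hy : y ∈ Ioo E.xlo E.xhi)
    (h : E.IsBest l y q) {z : ℝ} (hz : z ∈ Icc y E.xhi) (ht : l z = E.auditLine (l y) y q z) :
    y < z := by
  refine lt_of_le_of_ne hz.1 fun heq => ?_
  rw [← heq] at ht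
  have h1 := hs.lt_self hy.1
  have h2 := rent_nonneg hE h.1.1
  have h3 := mul_pos (h.snd_pos hE hs ⟨hy.1.le, hy.2⟩)
    (show 0 < y + E.τ by linarith [xlo_add_τ_pos hE, hy.1])
  have : l y < E.auditLine (l y) y q y := lt_min (by simpa using h1) (by linarith)
  linarith

theorem snd_lt_one (hE : E.Admissible) (hs : E.IsSmoothLoss l g c) (hy : y ∈ Ico E.xlo E.xhi)
    (h : E.IsBest l y q) : q.2 < 1 := by
  rcases hy.1.eq_or_lt with rfl | hlt
  · rw [h.snd_at_lo hE hs]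
    exact hs.lt_one _
  · refine lt_of_le_of_ne h.1.2.1.2 fun heq => ?_
    obtain ⟨z, hz, ht⟩ := h.exists_touch hE hs.isLossFn ⟨hy.1, hy.2.le⟩ (by rw [heq]; norm_num)
    have h1 := hs.lt_self (hlt.trans_le hz.1)
    have h2 := rent_nonneg hE h.1.1
    have h3 := hs.isLossFn.lo_le hy.1
    have h4 := hE.xlo_nonneg
    have h5 := hE.funds_pos
    rw [auditLine, heq, min_eq_left (by linarith)] at ht
    linarith

/-- The line of the optimal efforts touches the loss function only once. -/
theorem touch_unique (hE : E.Admissible) (hs : E.IsSmoothLoss l g c) (hy : y ∈ Ioo E.xlo E.xhi)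
    (h : E.IsBest l y q) {z z' : ℝ} (hz : z ∈ Icc y E.xhi) (hz' : z' ≤ E.xhi) (hzlo : E.xlo ≤ z')
    (ht : l z = E.auditLine (l y) y q z) (ht' : l z' = E.auditLine (l y) y q z') : z = z' := by
  have hp := h.snd_pos hE hs ⟨hy.1.le, hy.2⟩
  have hp1 := h.snd_lt_one hE hs ⟨hy.1.le, hy.2⟩
  have hv := lo_lt_auditLine hE hs.isLossFn h.1 hy.1 hp hp1
  have hg := h.touch_gt hE hs hy hz ht
  have hline : ∀ x ∈ Icc y E.xhi, l x ≤ E.auditLine (l y) y q 0 + q.2 * x := fun x hx => by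
    rw [← auditLine_eq]; exact le_auditLine h.1 hx
  rw [auditLine_eq] at ht ht' hv
  have hle : ∀ x ≤ E.xhi, l x ≤ E.auditLine (l y) y q 0 + q.2 * x :=
    fun x hx => hs.line_le hline ⟨hg, hz.2⟩ ht hx
  rcases lt_trichotomy z z' with h' | h' | h'
  · exact (hs.touch_unique hv.ne' (hy.1.le.trans hz.1) h'
      (fun x hx => hle x (hx.2.trans hz')) ht ht').elim
  · exact h'
  · exact (hs.touch_unique hv.ne' hzlo h' (fun x hx => hle x (hx.2.trans hz.2)) ht' ht).elim

end IsBest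

end SmoothLoss

/-! ### Monotone audits, doubly unique binding ICs and tightness -/

section Tightness

variable {E : Environment} {l g : ℝ → ℝ} {c : ℝ}

/-- Exchanging agent effort for principal effort at a rate below all types at which the line of the
optimal efforts is close to the loss function is feasible. -/
theorem IsBest.eventually_left_mem (hE : E.Admissible) (hl : E.IsLossFn l) {y : ℝ}
    (hy : E.xlo ≤ y) {q : ℝ × ℝ} (h : E.IsBest l y q) (he : 0 < q.1) (hp : q.2 < 1) {w : ℝ}
    (hw : 0 < w) (hslack : ∀ z ∈ Icc y E.xhi, z + E.τ ≤ w →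
      l z < l y + E.rent q.1 + q.2 * (z + E.τ)) :
    ∀ᶠ e in 𝓝[<] q.1, (e, (E.rent q.1 + q.2 * w - E.rent e) / w) ∈ E.auditSet l y := by
  have heI : q.1 ∈ Ioo (0 : ℝ) 1 := ⟨he, h.lt_one hE hl hy⟩
  have hcont : Tendsto E.rent (𝓝[<] q.1) (𝓝 (E.rent q.1)) :=
    (hasDerivAt_rent hE heI).continuousAt.tendsto.mono_left nhdsWithin_le_nhds
  have hlc := hl.continuous
  have hcomp : IsCompact (Icc y E.xhi ∩ {z | z + E.τ ≤ w}) :=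
    isCompact_Icc.inter_right (isClosed_le (by fun_prop) (by fun_prop))
  obtain ⟨σ, hσ, hσle⟩ := exists_pos_forall_le
    (f := fun z => l y + E.rent q.1 + q.2 * (z + E.τ) - l z) (by fun_prop) hcomp
    (fun z hz => by linarith [hslack z hz.1 hz.2])
  have h1w : 0 < (1 - q.2) * w := mul_pos (by linarith) hw
  filter_upwards [self_mem_nhdsWithin, nhdsWithin_le_nhds (lt_mem_nhds he),
    hcont.eventually (lt_mem_nhds (show E.rent q.1 - σ < E.rent q.1 by linarith)),
    hcont.eventually (lt_mem_nhds (show E.rent q.1 - (1 - q.2) * w < E.rent q.1 by linarith))]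
    with e hlt hpos hr1 hr2
  have heI' : e ∈ Icc (0 : ℝ) 1 := ⟨le_of_lt hpos, (le_of_lt hlt).trans h.1.1.2⟩
  have hmono := (rent_strictMono hE).monotoneOn heI' h.1.1 (le_of_lt hlt)
  have hp' : (E.rent q.1 + q.2 * w - E.rent e) / w = q.2 + (E.rent q.1 - E.rent e) / w := by
    field_simp; ring
  have hd : 0 ≤ (E.rent q.1 - E.rent e) / w := div_nonneg (by linarith) hw.le
  have hdw : (E.rent q.1 - E.rent e) / w * w = E.rent q.1 - E.rent e := div_mul_cancel₀ _ hw.ne'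
  rw [hp']
  refine ⟨heI', ⟨by linarith [h.1.2.1.1], ?_⟩, fun z hz => ?_⟩
  · have : (E.rent q.1 - E.rent e) / w ≤ 1 - q.2 := by
      rw [div_le_iff₀ hw]; linarith
    simp only; linarith
  · have h2 := h.1.2.2 z hz
    have hz0 : 0 ≤ z + E.τ := by linarith [hz.1, xlo_add_τ_pos hE]
    simp only
    constructor
    · have := mul_nonneg hd (sub_nonneg.2 hz.1)
      linarith [h2.1]
    · rcases le_total (z + E.τ) w with h3 | h3
      · have h4 := hσle z ⟨hz, h3⟩
        have := mul_nonneg hd hz0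
        linarith
      · have := mul_le_mul_of_nonneg_left h3 hd
        linarith [h2.2]

/-- Exchanging principal effort for agent effort at a rate above all types at which the line of the
optimal efforts is close to the loss function is feasible. -/
theorem IsBest.eventually_right_mem (hE : E.Admissible) (hl : E.IsLossFn l) {y : ℝ}
    (hy : E.xlo ≤ y) {q : ℝ × ℝ} (h : E.IsBest l y q) (he : 0 < q.1) (hp : 0 < q.2) {w : ℝ}
    (hw : 0 < w) (hslack : ∀ z ∈ Icc y E.xhi, w ≤ z + E.τ →
      l z < l y + E.rent q.1 + q.2 * (z + E.τ))
    (hG : ∀ z ∈ Icc y E.xhi, l z < y + q.2 * (z - y)) (hr : E.rent q.1 < y - l y) :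
    ∀ᶠ e in 𝓝[>] q.1, (e, (E.rent q.1 + q.2 * w - E.rent e) / w) ∈ E.auditSet l y ∧
      E.rent e - y ≤ -l y := by
  have heI : q.1 ∈ Ioo (0 : ℝ) 1 := ⟨he, h.lt_one hE hl hy⟩
  have hcont : Tendsto E.rent (𝓝[>] q.1) (𝓝 (E.rent q.1)) :=
    (hasDerivAt_rent hE heI).continuousAt.tendsto.mono_left nhdsWithin_le_nhds
  have hlc := hl.continuous
  have hcomp : IsCompact (Icc y E.xhi ∩ {z | w ≤ z + E.τ}) :=
    isCompact_Icc.inter_right (isClosed_le (by fun_prop) (by fun_prop))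
  obtain ⟨σ, hσ, hσle⟩ := exists_pos_forall_le
    (f := fun z => l y + E.rent q.1 + q.2 * (z + E.τ) - l z) (by fun_prop) hcomp
    (fun z hz => by linarith [hslack z hz.1 hz.2])
  obtain ⟨σ', hσ', hσle'⟩ := exists_pos_forall_le
    (f := fun z => y + q.2 * (z - y) - l z) (by fun_prop) isCompact_Icc
    (fun z hz => by linarith [hG z hz])
  have hlim : Tendsto (fun e => (E.rent e - E.rent q.1) / w * (E.xhi + E.τ)) (𝓝[>] q.1) (𝓝 0) := by
    have := ((hcont.sub_const (E.rent q.1)).div_const w).mul_const (E.xhi + E.τ)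
    simpa using this
  have hlim2 : Tendsto (fun e => (E.rent e - E.rent q.1) / w) (𝓝[>] q.1) (𝓝 0) := by
    have := (hcont.sub_const (E.rent q.1)).div_const w
    simpa using this
  filter_upwards [self_mem_nhdsWithin, nhdsWithin_le_nhds (gt_mem_nhds heI.2),
    hcont.eventually (gt_mem_nhds hr), hlim.eventually (gt_mem_nhds hσ),
    hlim.eventually (gt_mem_nhds hσ'), hlim2.eventually (gt_mem_nhds hp)]
    with e hlt hlt1 hre hs1 hs2 hs3
  have heI' : e ∈ Icc (0 : ℝ) 1 := ⟨he.le.trans (le_of_lt hlt), le_of_lt hlt1⟩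
  have hmono := (rent_strictMono hE).monotoneOn h.1.1 heI' (le_of_lt hlt)
  have hp' : (E.rent q.1 + q.2 * w - E.rent e) / w = q.2 - (E.rent e - E.rent q.1) / w := by
    field_simp; ring
  have hd : 0 ≤ (E.rent e - E.rent q.1) / w := div_nonneg (by linarith) hw.le
  have hdw : (E.rent e - E.rent q.1) / w * w = E.rent e - E.rent q.1 := div_mul_cancel₀ _ hw.ne'
  rw [hp']
  refine ⟨⟨heI', ⟨by simp only; linarith, by simp only; linarith [h.1.2.1.2]⟩, fun z hz => ?_⟩,
    by linarith⟩
  have h2 := h.1.2.2 z hz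
  have hlo := hE.xlo_nonneg
  have hτ := hE.funds_pos
  simp only
  constructor
  · have h3 := hσle' z hz
    have h4 : (E.rent e - E.rent q.1) / w * (z - y) ≤
        (E.rent e - E.rent q.1) / w * (E.xhi + E.τ) :=
      mul_le_mul_of_nonneg_left (by linarith [hz.2]) hd
    linarith
  · rcases le_total w (z + E.τ) with h3 | h3
    · have h5 := hσle z ⟨hz, h3⟩
      have h4 : (E.rent e - E.rent q.1) / w * (z + E.τ) ≤
          (E.rent e - E.rent q.1) / w * (E.xhi + E.τ) :=
        mul_le_mul_of_nonneg_left (by linarith [hz.2]) hd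
      linarith
    · have := mul_le_mul_of_nonneg_left h3 hd
      linarith [h2.2]

/-- The optimal principal effort is strictly decreasing in the type. -/
theorem IsSmoothLoss.snd_lt_snd (hE : E.Admissible) (hs : E.IsSmoothLoss l g c) {y₁ y₂ : ℝ}
    (h₁ : y₁ ∈ Ico E.xlo E.xhi) (h₂ : y₂ ∈ Ico E.xlo E.xhi) (hlt : y₁ < y₂) {q₁ q₂ : ℝ × ℝ}
    (hq₁ : E.IsBest l y₁ q₁) (hq₂ : E.IsBest l y₂ q₂) : q₂.2 < q₁.2 := by
  by_contra hcon
  push Not at hcon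
  have hl := hs.isLossFn
  have hlo := hE.xlo_nonneg
  have hτ := hE.funds_pos
  have hy₂ : y₂ ∈ Ioo E.xlo E.xhi := ⟨h₁.1.trans_lt hlt, h₂.2⟩
  have hp₁ := hq₁.snd_pos hE hs h₁
  have hp₂ := hq₂.snd_pos hE hs h₂
  have hp₁' := hq₁.snd_lt_one hE hs h₁
  have hp₂' := hq₂.snd_lt_one hE hs h₂
  -- If the effort at `y₂` were not smaller, the first family at `y₁` would make the first family at
  -- `y₂` slack. The line at `y₂` then touches through the second family, which in turn forces a
  -- lower agent effort at `y₂`.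
  have hG : ∀ z ∈ Icc y₂ E.xhi, l z < y₂ + q₂.2 * (z - y₂) := by
    intro z hz
    have h3 := (hq₁.1.2.2 z ⟨hlt.le.trans hz.1, hz.2⟩).1
    have h4 : q₁.2 * (z - y₂) ≤ q₂.2 * (z - y₂) :=
      mul_le_mul_of_nonneg_right hcon (by linarith [hz.1])
    have h5 : 0 < (1 - q₁.2) * (y₂ - y₁) := mul_pos (by linarith) (by linarith)
    linarith
  obtain ⟨z₂, hz₂, ht₂⟩ := hq₂.exists_touch hE hl ⟨h₂.1, h₂.2.le⟩ hp₂
  have hgt := hq₂.touch_gt hE hs hy₂ hz₂ ht₂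
  have hH₂ : l z₂ = l y₂ + E.rent q₂.1 + q₂.2 * (z₂ + E.τ) := by
    rcases min_choice (y₂ + q₂.2 * (z₂ - y₂)) (l y₂ + E.rent q₂.1 + q₂.2 * (z₂ + E.τ))
      with h' | h'
    · rw [auditLine, h'] at ht₂
      exact absurd ht₂ (hG z₂ hz₂).ne
    · rwa [auditLine, h'] at ht₂
  have hz₂τ : 0 < z₂ + E.τ := by linarith [hy₂.1]
  have hH₁ := (hq₁.1.2.2 z₂ ⟨hlt.le.trans hz₂.1, hz₂.2⟩).2
  have hly := hs.strictMono hlt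
  have hrent : E.rent q₂.1 < E.rent q₁.1 := by
    have := mul_le_mul_of_nonneg_right hcon hz₂τ.le
    linarith
  have he : q₂.1 < q₁.1 := ((rent_strictMono hE).lt_iff_lt hq₂.1.1 hq₁.1.1).1 hrent
  have he₂ : 0 < q₂.1 := hq₂.fst_pos hE (hs.lt_self hy₂.1) hp₂
  have he₁ : 0 < q₁.1 := he₂.trans he
  -- the line at `y₂` is strictly above the loss function except at `z₂`
  have hstrict : ∀ z, E.xlo ≤ z → z ≤ E.xhi → z ≠ z₂ →
      l z < l y₂ + E.rent q₂.1 + q₂.2 * (z + E.τ) := by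
    intro z hzlo hzhi hne
    have hle : l z ≤ E.auditLine (l y₂) y₂ q₂ z := by
      rw [auditLine_eq]
      refine hs.line_le (fun x hx => ?_) ⟨hgt, hz₂.2⟩ (by rw [← auditLine_eq]; exact ht₂) hzhi
      rw [← auditLine_eq]; exact le_auditLine hq₂.1 hx
    refine lt_of_lt_of_le (lt_of_le_of_ne hle fun heq => hne ?_) (min_le_right _ _)
    exact (hq₂.touch_unique hE hs hy₂ hz₂ hzhi hzlo ht₂ heq).symm
  have hr₂ : E.rent q₂.1 < y₂ - l y₂ := by
    have h3 := hG z₂ hz₂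
    have h4 : 0 < q₂.2 * (y₂ + E.τ) := mul_pos hp₂ (by linarith [hy₂.1])
    linarith
  set X₁ := (1 - q₁.1) * (q₁.1 * costDeriv 2 E.cA q₁.1) with hX₁
  set X₂ := (1 - q₂.1) * (q₂.1 * costDeriv 2 E.cA q₂.1) with hX₂
  -- The constraint at `y₁` is slack left of `z₂`, and at `y₂` it is slack right of `z₂`. Exchange
  -- rates strictly below and above `z₂ + τ` are therefore feasible for the respective
  -- perturbations; both first-order conditions are then passed to the limit `w = z₂ + τ`.
  have hleft : ∀ w ∈ Ioo 0 (z₂ + E.τ), costDeriv 1 E.cA q₁.1 - E.cP q₁.2 -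
      costExtDeriv E.cP q₁.2 / w * X₁ ≤ 0 := by
    intro w hw
    refine hq₁.foc_left hE hl h₁.1 he₁ hw.1
      (hq₁.eventually_left_mem hE hl h₁.1 he₁ hp₁' hw.1 fun z hz hzw => ?_)
    have hzz : z < z₂ := by linarith [hw.2]
    have h3 := hstrict z (h₁.1.trans hz.1) hz.2 hzz.ne
    have h4 : 0 ≤ (q₂.2 - q₁.2) * (z₂ - z) := mul_nonneg (by linarith) (by linarith)
    linarith
  have hright : ∀ w ∈ Ioi (z₂ + E.τ), 0 ≤ costDeriv 1 E.cA q₂.1 - E.cP q₂.2 -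
      costExtDeriv E.cP q₂.2 / w * X₂ := by
    intro w hw
    have hw0 : 0 < w := hz₂τ.trans hw
    refine hq₂.foc_right hE hl h₂.1 he₂ hw0
      (hq₂.eventually_right_mem hE hl h₂.1 he₂ hp₂ hw0 (fun z hz hzw => ?_) hG hr₂)
    have hzz : z₂ < z := by linarith [mem_Ioi.1 hw]
    exact hstrict z (h₂.1.trans hz.1) hz.2 hzz.ne'
  have hcw : ∀ a b d : ℝ, ContinuousAt (fun w : ℝ => a - b / w * d) (z₂ + E.τ) := fun a b d =>
    (continuousAt_const.sub ((continuousAt_const.div continuousAt_id hz₂τ.ne').mul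
      continuousAt_const))
  have hL := le_of_tendsto ((hcw (costDeriv 1 E.cA q₁.1 - E.cP q₁.2)
    (costExtDeriv E.cP q₁.2) X₁).tendsto.mono_left (nhdsWithin_le_nhds (s := Iio (z₂ + E.τ)))) (by
      filter_upwards [self_mem_nhdsWithin, nhdsWithin_le_nhds (lt_mem_nhds hz₂τ)] with w hw hw0
      exact hleft w ⟨hw0, hw⟩)
  have hR := ge_of_tendsto ((hcw (costDeriv 1 E.cA q₂.1 - E.cP q₂.2)
    (costExtDeriv E.cP q₂.2) X₂).tendsto.mono_left (nhdsWithin_le_nhds (s := Ioi (z₂ + E.τ)))) (by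
      filter_upwards [self_mem_nhdsWithin] with w hw
      exact hright w hw)
  have hcP := hE.cost_principal
  -- The conditions say that virtual cost is at most `c_P` of the effort at `y₁` and at least that
  -- at `y₂`. Agent effort is higher at `y₁` and the weight on the virtual term is lower, so strict
  -- monotonicity contradicts the assumed order of principal efforts.
  have hV := virtualCost_strictMono hE (κ := costExtDeriv E.cP q₁.2 / (z₂ + E.τ))
    (div_nonneg (hcP.costExtDeriv_nonneg _) hz₂τ.le) (by
      rw [div_mul_eq_mul_div, div_le_iff₀ hz₂τ]
      exact mul_le_mul (hcP.costExtDeriv_le _) (by linarith [hy₂.1]) (xlo_add_τ_pos hE).le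
        hcP.deriv_one_pos.le)
    ⟨he₂, hq₂.lt_one hE hl h₂.1⟩ ⟨he₁, hq₁.lt_one hE hl h₁.1⟩ he
  simp only at hV
  rw [← hX₁, ← hX₂] at hV
  have hX₂0 : 0 ≤ X₂ := mul_nonneg (by linarith [hq₂.1.1.2]) (mul_nonneg he₂.le
    (hE.cost_agent.deriv_two_nonneg ⟨he₂, hq₂.lt_one hE hl h₂.1⟩))
  have hκ : costExtDeriv E.cP q₁.2 / (z₂ + E.τ) * X₂ ≤ costExtDeriv E.cP q₂.2 / (z₂ + E.τ) * X₂ :=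
    mul_le_mul_of_nonneg_right (div_le_div_of_nonneg_right (hcP.costExtDeriv_mono hcon) hz₂τ.le)
      hX₂0
  have hcp := hcP.strict_mono.monotoneOn hq₁.1.2.1 hq₂.1.2.1 hcon
  linarith

theorem IsSmoothLoss.strictAntiOn_snd (hE : E.Admissible) (hs : E.IsSmoothLoss l g c) :
    StrictAntiOn (fun y => (E.bestEfforts l y).2) (Ico E.xlo E.xhi) := fun _ h₁ _ h₂ hlt =>
  hs.snd_lt_snd hE h₁ h₂ hlt (bestEfforts_spec hE hs.isLossFn h₁.1)
    (bestEfforts_spec hE hs.isLossFn h₂.1)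

/-- Constraint on the principal effort, approximated from above, where the loss is below the
type. -/
theorem eventually_le_of_lt_self {ι : Type*} {F : Filter ι} {L : ι → ℝ → ℝ} {Y : ι → ℝ} {y p : ℝ}
    (hL : ∀ i, E.IsLossFn (L i)) (hl : E.IsLossFn l)
    (hYI : ∀ᶠ i in F, Y i ∈ Icc E.xlo E.xhi) (hY : Tendsto Y F (𝓝 y))
    (hLl : ∀ ε > 0, ∀ᶠ i in F, ∀ z ∈ Icc E.xlo E.xhi, |L i z - l z| ≤ ε) (hly : l y < y)
    (hp : p ∈ Icc (0 : ℝ) 1) (hG : ∀ z ∈ Icc y E.xhi, l z ≤ y + p * (z - y)) {δ : ℝ} (hδ : 0 < δ) :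
    ∀ᶠ i in F, ∀ z ∈ Icc (Y i) E.xhi, L i z ≤ Y i + (p + δ) * (z - Y i) := by
  set η := (y - l y) / 4 with hη
  have hη0 : 0 < η := by rw [hη]; linarith
  have hδη : 0 < δ * η := mul_pos hδ hη0
  filter_upwards [hYI, hLl (min η (δ * η / 2)) (by positivity),
    hY.eventually (Ioo_mem_nhds (show y - min η (δ * η / 2) < y by
      have : 0 < min η (δ * η / 2) := by positivity
      linarith) (show y < y + min η (δ * η / 2) by
      have : 0 < min η (δ * η / 2) := by positivity
      linarith))] with i hYi hLi hYn z hz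
  have hm1 := min_le_left η (δ * η / 2)
  have hm2 := min_le_right η (δ * η / 2)
  have hzI : z ∈ Icc E.xlo E.xhi := ⟨hYi.1.trans hz.1, hz.2⟩
  -- The inequality is trivial unless `L i z` exceeds `Y i`; the Lipschitz bound then puts `z` at
  -- distance more than `η` from `Y i`, and the slack `δ * η` beats the approximation error.
  by_cases hcase : L i z ≤ Y i
  · have := mul_nonneg (add_nonneg hp.1 hδ.le) (sub_nonneg.2 hz.1)
    linarith
  · push Not at hcase
    have h1 := (hL i).lip (Y i) z hz.1
    have h2 := abs_le.1 (hLi (Y i) hYi)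
    have h3 : l (Y i) ≤ l y + min η (δ * η / 2) := by
      rcases le_total y (Y i) with h | h
      · have := hl.lip _ _ h
        linarith [hYn.2]
      · have := hl.mono h
        have : 0 < min η (δ * η / 2) := by positivity
        linarith
    have h4 : η < z - Y i := by linarith [h2.2, hYn.1]
    have hyz : y ≤ z := by linarith [hYn.1]
    have h5 := hG z ⟨hyz, hz.2⟩
    have h6 := abs_le.1 (hLi z hzI)
    have h7 : δ * η ≤ δ * (z - Y i) := mul_le_mul_of_nonneg_left h4.le hδ.le
    have h8 : (1 - p) * (y - Y i) ≤ min η (δ * η / 2) := by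
      have : 0 < min η (δ * η / 2) := by positivity
      nlinarith [hp.1, hp.2, hYn.1]
    linarith [h6.2]

theorem IsSmoothLoss.continuousOn_bestEfforts (hE : E.Admissible) (hs : E.IsSmoothLoss l g c) :
    ContinuousOn (E.bestEfforts l) (Icc E.xlo E.xhi) := by
  intro y hy
  have hl := hs.isLossFn
  have hid : Tendsto (fun x : ℝ => x) (𝓝[Icc E.xlo E.xhi] y) (𝓝 y) :=
    tendsto_nhdsWithin_of_tendsto_nhds tendsto_id
  have hmem : ∀ᶠ x in 𝓝[Icc E.xlo E.xhi] y, x ∈ Icc E.xlo E.xhi := self_mem_nhdsWithin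
  have hq := bestEfforts_spec hE hl hy.1
  have hLl : ∀ ε > 0, ∀ᶠ _ in 𝓝[Icc E.xlo E.xhi] y, ∀ z ∈ Icc E.xlo E.xhi, |l z - l z| ≤ ε :=
    fun ε hε => Eventually.of_forall fun _ z _ => by simpa using le_of_lt hε
  refine IsBest.tendsto hE (L := fun _ => l) (Y := fun x => x) (fun _ => hl) hl hmem hy hid hLl
    (hmem.mono fun x hx => bestEfforts_spec hE hl hx.1) hq fun δ hδ hδ1 => ?_
  -- At `xlo` the loss equals the type, so the slack argument fails; but nearby advances lie to the
  -- right and inherit the constraint directly.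
  rcases hy.1.eq_or_lt with heq | hlt
  · filter_upwards [hmem] with x hx z hz
    have h1 := (hq.1.2.2 z ⟨heq ▸ hx.1.trans hz.1, hz.2⟩).1
    have h2 : 0 ≤ (1 - (E.bestEfforts l y).2) * (x - y) :=
      mul_nonneg (by linarith [hq.1.2.1.2]) (by linarith [hx.1])
    have h3 := mul_nonneg hδ.le (sub_nonneg.2 hz.1)
    linarith
  · exact eventually_le_of_lt_self (fun _ => hl) hl hmem hid hLl (hs.lt_self hlt) hq.1.2.1
      (fun z hz => (hq.1.2.2 z hz).1) hδ

/-- Every type on the strictly concave part is touched by the line of a lower type. -/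
theorem IsSmoothLoss.exists_touching (hE : E.Admissible) (hs : E.IsSmoothLoss l g c) {x : ℝ}
    (hx : x ∈ Ioc c E.xhi) : ∃ y ∈ Ioo E.xlo E.xhi, y < x ∧ (E.bestEfforts l y).2 = g x ∧
      l x = E.auditLine (l y) y (E.bestEfforts l y) x := by
  have hl := hs.isLossFn
  have hlt := hE.xlo_lt_xhi
  have hc : ContinuousOn (fun y => (E.bestEfforts l y).2) (Icc E.xlo E.xhi) :=
    continuous_snd.comp_continuousOn (hs.continuousOn_bestEfforts hE)
  have h0 := (bestEfforts_spec hE hl le_rfl).snd_at_lo hE hs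
  have h1 := (bestEfforts_spec hE hl hlt.le).snd_at_hi hE hs
  have hgx : g x < g E.xlo := by
    rw [← hs.const c le_rfl]
    exact hs.strictAnti self_mem_Ici hx.1.le hx.1
  -- Principal effort moves continuously from the initial slope of `l` to `0`, so some advance has
  -- slope `g x`. On the strictly concave part, a line of that slope above `l` can touch only at
  -- `x`.
  obtain ⟨y, hy, hyx⟩ := intermediate_value_Icc' hlt.le hc
    (show g x ∈ Icc ((E.bestEfforts l E.xhi).2) ((E.bestEfforts l E.xlo).2) from
      ⟨by rw [h1]; exact (hs.pos x).le, by rw [h0]; exact hgx.le⟩)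
  simp only at hyx
  have hylo : E.xlo ≠ y := fun h => by rw [← h, h0] at hyx; linarith
  have hyhi : y ≠ E.xhi := fun h => by rw [h, h1] at hyx; linarith [hs.pos x]
  have hyI : y ∈ Ioo E.xlo E.xhi := ⟨lt_of_le_of_ne hy.1 hylo, lt_of_le_of_ne hy.2 hyhi⟩
  have hq := bestEfforts_spec hE hl hy.1
  obtain ⟨z, hz, ht⟩ := hq.exists_touch hE hl hy (by rw [hyx]; exact hs.pos x)
  have hgt := hq.touch_gt hE hs hyI hz ht
  have hzx : z = x := by
    by_contra hne
    have h2 := hs.tangent_lt hx.1 hne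
    have h3 := hs.line_le (x := x) (fun w hw => by
      rw [← auditLine_eq]; exact le_auditLine hq.1 hw) ⟨hgt, hz.2⟩ (by rw [← auditLine_eq]; exact ht)
      hx.2
    rw [auditLine_eq] at ht
    rw [hyx] at ht h3
    linarith
  subst hzx
  exact ⟨y, hyI, hgt, hyx, ht⟩

theorem IsSmoothLoss.loss_eq (hE : E.Admissible) (hs : E.IsSmoothLoss l g c) {x : ℝ}
    (hx : x ∈ Icc E.xlo E.xhi) : E.loss (E.implement l) x = l x := by
  have hl := hs.isLossFn
  refine le_antisymm ?_ (le_implement_loss hE hl hx)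
  have hfeas := implement_feasible hE hl
  rcases le_or_gt x c with h | h
  · refine (loss_le_deviationLoss hE hfeas hx.2 ⟨le_rfl, hx.1⟩).trans ?_
    rw [implement_deviationLoss hE hl le_rfl]
    refine (min_le_left _ _).trans ?_
    rw [(bestEfforts_spec hE hl le_rfl).snd_at_lo hE hs, hs.eq_of_le hx.1 h]
  · obtain ⟨y, hy, hyx, -, ht⟩ := hs.exists_touching hE ⟨h, hx.2⟩
    refine (loss_le_deviationLoss hE hfeas hx.2 ⟨hy.1.le, hyx.le⟩).trans ?_
    rw [implement_deviationLoss hE hl hy.1.le]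
    exact ht.ge

theorem IsSmoothLoss.mem_bindingIC (hE : E.Admissible) (hs : E.IsSmoothLoss l g c) {x y : ℝ}
    (hy : E.xlo ≤ y) : x ∈ E.bindingIC (E.implement l) y ↔
      x ∈ Icc y E.xhi ∧ l x = E.auditLine (l y) y (E.bestEfforts l y) x := by
  simp only [bindingIC, mem_ofPred_eq]
  refine and_congr_right fun hx => ?_
  rw [hs.loss_eq hE ⟨hy.trans hx.1, hx.2⟩, implement_deviationLoss hE hs.isLossFn hy]
  rfl

/-- One direction is uniqueness of the touching point. For the other, at an interior binding type
`x` the line is tangent to `l`, so the principal effort equals `g x`, and strict monotonicity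
identifies the advance. -/
theorem IsSmoothLoss.doublyUnique (hE : E.Admissible) (hs : E.IsSmoothLoss l g c) :
    E.DoublyUnique (E.implement l) := by
  have hl := hs.isLossFn
  constructor
  · intro y hy
    have hq := bestEfforts_spec hE hl hy.1.le
    obtain ⟨z, hz, ht⟩ := hq.exists_touch hE hl ⟨hy.1.le, hy.2.le⟩
      (hq.snd_pos hE hs ⟨hy.1.le, hy.2⟩)
    refine ⟨z, (hs.mem_bindingIC hE hy.1.le).2 ⟨hz, ht⟩, fun z' hz' => ?_⟩
    obtain ⟨hz'1, ht'⟩ := (hs.mem_bindingIC hE hy.1.le).1 hz'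
    exact (hq.touch_unique hE hs hy hz hz'1.2 (hy.1.le.trans hz'1.1) ht ht').symm
  · intro x hx
    have key : ∀ y ∈ Ioo E.xlo E.xhi, x ∈ E.bindingIC (E.implement l) y →
        (E.bestEfforts l y).2 = g x := by
      intro y hy hxy
      obtain ⟨hxI, ht⟩ := (hs.mem_bindingIC hE hy.1.le).1 hxy
      have hq := bestEfforts_spec hE hl hy.1.le
      have hgt := hq.touch_gt hE hs hy hxI ht
      have hmin : IsLocalMin (fun z => E.auditLine (l y) y (E.bestEfforts l y) 0 +
          (E.bestEfforts l y).2 * z - l z) x := by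
        filter_upwards [Ioo_mem_nhds hgt hx.2] with z hz
        have h1 := le_auditLine hq.1 (z := z) ⟨hz.1.le, hz.2.le⟩
        rw [auditLine_eq] at h1 ht
        linarith
      have hd : HasDerivAt (fun z => E.auditLine (l y) y (E.bestEfforts l y) 0 +
          (E.bestEfforts l y).2 * z - l z) ((E.bestEfforts l y).2 * 1 - g x) x :=
        (((hasDerivAt_id x).const_mul _).const_add _).sub (hs.hasDerivAt x)
      have := hmin.hasDerivAt_eq_zero hd
      linarith
    rintro y ⟨hy, hxy⟩ y' ⟨hy', hxy'⟩
    exact (hs.strictAntiOn_snd hE).injOn ⟨hy.1.le, hy.2⟩ ⟨hy'.1.le, hy'.2⟩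
      ((key y hy hxy).trans (key y' hy' hxy').symm)

/-- A loss function that is above `l` and weakly more profitable everywhere coincides
with `l`. -/
theorem IsSmoothLoss.eq_of_profitable (hE : E.Admissible) (hs : E.IsSmoothLoss l g c) {l' : ℝ → ℝ}
    (hl' : E.IsLossFn l') (hle : ∀ x ∈ Icc E.xlo E.xhi, l x ≤ l' x)
    (hprofit : ∀ x ∈ Icc E.xlo E.xhi, E.auditCost (l' x) x (E.bestEfforts l' x) ≤
      E.auditCost (l x) x (E.bestEfforts l x)) {x : ℝ} (hx : x ∈ Icc E.xlo E.xhi) :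
    l' x = l x := by
  have hl := hs.isLossFn
  -- Where the two loss functions agree, the efforts for `l'` are feasible for `l` and no more
  -- costly, so uniqueness identifies them. Hence `l'` lies below the line that `l` generates at
  -- `y`.
  have hline : ∀ y ∈ Icc E.xlo E.xhi, l' y = l y → ∀ z ∈ Icc y E.xhi,
      l' z ≤ E.auditLine (l y) y (E.bestEfforts l y) z := by
    intro y hy heq z hz
    have hq := bestEfforts_spec hE hl hy.1
    have hq' := bestEfforts_spec hE hl' hy.1
    have hmem : E.bestEfforts l' y ∈ E.auditSet l y := by
      refine ⟨hq'.1.1, hq'.1.2.1, fun w hw => ?_⟩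
      have h1 := hq'.1.2.2 w hw
      have h2 := hle w ⟨hy.1.trans hw.1, hw.2⟩
      rw [heq] at h1
      exact ⟨h2.trans h1.1, h2.trans h1.2⟩
    have hp := hprofit y hy
    rw [heq] at hp
    have hbest : E.IsBest l y (E.bestEfforts l' y) :=
      ⟨hmem, fun r hr => hp.trans (hq.2 r hr)⟩
    rw [hq.unique hE hl hy hbest, ← heq]
    exact le_auditLine hq'.1 hz
  have hinit : ∀ z ∈ Icc E.xlo c, l' z = l z := by
    intro z hz
    have hzI : z ∈ Icc E.xlo E.xhi := ⟨hz.1, hz.2.trans hs.mem.2.le⟩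
    refine le_antisymm ?_ (hle z hzI)
    refine (hline E.xlo ⟨le_rfl, hE.xlo_lt_xhi.le⟩ (hl'.at_lo.trans hl.at_lo.symm) z hzI).trans ?_
    refine (min_le_left _ _).trans ?_
    rw [(bestEfforts_spec hE hl le_rfl).snd_at_lo hE hs, hs.eq_of_le hz.1 hz.2]
  by_contra hne
  set S := {z | z ∈ Icc E.xlo E.xhi ∧ l' z ≠ l z} with hS
  have hSne : S.Nonempty := ⟨x, hx, hne⟩
  have hSbdd : BddBelow S := ⟨E.xlo, fun z hz => hz.1.1⟩
  set y₀ := sInf S with hy₀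
  have hbelow : ∀ z ∈ Icc E.xlo E.xhi, z < y₀ → l' z = l z := by
    intro z hz hlt
    by_contra h
    exact absurd (csInf_le hSbdd ⟨hz, h⟩) (not_le.2 hlt)
  have hcy : c ≤ y₀ := by
    refine le_csInf hSne fun z hz => ?_
    by_contra h
    exact hz.2 (hinit z ⟨hz.1.1, (not_le.1 h).le⟩)
  have hyhi : y₀ ≤ E.xhi := (csInf_le hSbdd ⟨hx, hne⟩).trans hx.2
  have hylo : E.xlo < y₀ := hs.mem.1.trans_le hcy
  have heq₀ : l' y₀ = l y₀ := by
    have h1 : Tendsto l' (𝓝[<] y₀) (𝓝 (l' y₀)) :=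
      (hl'.continuous.tendsto _).mono_left nhdsWithin_le_nhds
    have h2 : Tendsto l (𝓝[<] y₀) (𝓝 (l y₀)) :=
      (hl.continuous.tendsto _).mono_left nhdsWithin_le_nhds
    refine tendsto_nhds_unique_of_eventuallyEq h1 h2 ?_
    filter_upwards [self_mem_nhdsWithin, nhdsWithin_le_nhds (lt_mem_nhds hylo)] with z hz hz'
    exact hbelow z ⟨le_of_lt hz', (le_of_lt hz).trans hyhi⟩ hz
  have hlt₀ : y₀ < E.xhi := by
    refine lt_of_le_of_ne hyhi fun h => ?_
    have hx0 := csInf_le hSbdd (show x ∈ S from ⟨hx, hne⟩)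
    have : x = y₀ := le_antisymm (h ▸ hx.2) hx0
    exact hne (this ▸ heq₀)
  have hyI : y₀ ∈ Ioo E.xlo E.xhi := ⟨hylo, hlt₀⟩
  have hq₀ := bestEfforts_spec hE hl hylo.le
  obtain ⟨z₀, hz₀, ht₀⟩ := hq₀.exists_touch hE hl ⟨hylo.le, hyhi⟩
    (hq₀.snd_pos hE hs ⟨hylo.le, hlt₀⟩)
  have hgt := hq₀.touch_gt hE hs hyI hz₀ ht₀
  obtain ⟨w, hwS, hwz⟩ := exists_lt_of_csInf_lt hSne hgt
  have hyw : y₀ ≤ w := csInf_le hSbdd hwS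
  have hyw' : y₀ < w := lt_of_le_of_ne hyw fun h => hwS.2 (h ▸ heq₀)
  obtain ⟨y, hy, hyltw, hyg, hty⟩ := hs.exists_touching hE (x := w)
    ⟨hcy.trans_lt hyw', hwS.1.2⟩
  -- If `y` came after `y₀`, the line at `y₀` would be steeper than `g w`; being above `l` at `w`,
  -- it could not touch `l` at the later point `z₀`.
  have hyy : y ≤ y₀ := by
    by_contra hcon
    push Not at hcon
    have h1 := hs.strictAntiOn_snd hE ⟨hylo.le, hlt₀⟩ ⟨hy.1.le, hy.2⟩ hcon
    simp only at h1
    rw [hyg] at h1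
    have h2 := le_auditLine hq₀.1 (z := w) ⟨hyw, hwS.1.2⟩
    have h3 := hs.tangent_le w z₀
    rw [auditLine_eq] at h2 ht₀
    have h4 := mul_lt_mul_of_pos_right h1 (show 0 < z₀ - w by linarith)
    linarith
  have heqy : l' y = l y := by
    rcases hyy.eq_or_lt with h | h
    · rw [h]; exact heq₀
    · exact hbelow y ⟨hy.1.le, hy.2.le⟩ h
  have h5 := hline y ⟨hy.1.le, hy.2.le⟩ heqy w ⟨hyltw.le, hwS.1.2⟩
  rw [← hty] at h5
  exact hwS.2 (le_antisymm h5 (hle w hwS.1))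

/-- The hull of the loss of a tighter mechanism is a larger, weakly more profitable loss function,
so it coincides with `l` on the type space. The profit of that mechanism is then bounded by the
optimum for `l`. -/
theorem IsSmoothLoss.isTight (hE : E.Admissible) (hs : E.IsSmoothLoss l g c) :
    E.IsTight (E.implement l) := by
  have hl := hs.isLossFn
  refine ⟨implement_isMechanism hE hl, fun m' hm' htight => ?_⟩
  have hself : ∀ x ∈ Icc E.xlo E.xhi, E.loss m' x ≤ x := fun x hx => loss_le_self hE hm'.1 hx
  set H := E.lossHull (E.loss m') with hH
  have hHl : E.IsLossFn H := lossHull_isLossFn hself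
  have hprof : ∀ x ∈ Icc E.xlo E.xhi, E.profit m' x ≤ -E.auditCost (H x) x (E.bestEfforts H x) := by
    intro x hx
    obtain ⟨q, hq, hle, -⟩ := exists_mem_auditSet_lossHull hE hm' hx
    have := (bestEfforts_spec hE hHl hx.1).2 q hq
    linarith
  have hHeq : ∀ x ∈ Icc E.xlo E.xhi, H x = l x := by
    intro x hx
    refine hs.eq_of_profitable hE hHl (fun z hz => ?_) (fun z hz => ?_) hx
    · have := (htight z hz).2
      rw [hs.loss_eq hE hz] at this
      exact this.trans (self_le_lossHull hself hz)
    · have := (htight z hz).1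
      rw [implement_profit hE hl hz.1] at this
      linarith [hprof z hz]
  intro x hx
  have hset : E.auditSet H x = E.auditSet l x := by
    ext q
    simp only [auditSet, mem_ofPred_eq]
    refine and_congr_right fun _ => and_congr_right fun _ => forall₂_congr fun z hz => ?_
    rw [hHeq z ⟨hx.1.trans hz.1, hz.2⟩, hHeq x hx]
  constructor
  · rw [implement_profit hE hl hx.1]
    have h1 := hprof x hx
    have h2 := (bestEfforts_spec hE hl hx.1).2 (E.bestEfforts H x)
      (hset ▸ (bestEfforts_spec hE hHl hx.1).1)
    rw [hHeq x hx] at h1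
    linarith
  · rw [hs.loss_eq hE hx, ← hHeq x hx]
    exact self_le_lossHull hself hx

end Tightness

/-! ### Smooth approximation of a concave loss function -/

section Approximation

variable {E : Environment} {L : ℝ → ℝ} {h ε : ℝ}

/-- The increments of a concave function are decreasing. -/
theorem antitone_increment_of_concaveOn (hL : ConcaveOn ℝ univ L) (hh : 0 < h) :
    Antitone fun u => L (u + h) - L u := by
  intro u v huv
  have hd : 0 < v - u + h := by linarith
  have h0 : 0 ≤ (v - u) / (v - u + h) := div_nonneg (by linarith) hd.le
  have h1 : 0 ≤ h / (v - u + h) := div_nonneg hh.le hd.le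
  have hsum : (v - u) / (v - u + h) + h / (v - u + h) = 1 := by
    rw [← add_div, div_self hd.ne']
  have e1 := hL.2 (mem_univ u) (mem_univ (v + h)) h1 h0 (by rw [add_comm]; exact hsum)
  have e2 := hL.2 (mem_univ u) (mem_univ (v + h)) h0 h1 hsum
  simp only [smul_eq_mul] at e1 e2
  rw [show h / (v - u + h) * u + (v - u) / (v - u + h) * (v + h) = v by field_simp; ring] at e1
  rw [show (v - u) / (v - u + h) * u + h / (v - u + h) * (v + h) = u + h by
    field_simp; ring] at e2
  have e3 : L u = ((v - u) / (v - u + h) + h / (v - u + h)) * L u := by rw [hsum, one_mul]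
  have e4 : L (v + h) = ((v - u) / (v - u + h) + h / (v - u + h)) * L (v + h) := by
    rw [hsum, one_mul]
  simp only
  linarith

/-- The slope of the smooth approximation of `L`: a mixture of the forward difference quotient of
`L` and of a strictly decreasing function, both frozen up to `E.xlo + h`. -/
def smoothSlope (E : Environment) (L : ℝ → ℝ) (h ε x : ℝ) : ℝ :=
  (1 - ε) * ((L (max x (E.xlo + h) + h) - L (max x (E.xlo + h))) / h) +
    ε * Real.exp (-(max x (E.xlo + h) - E.xlo))

/-- A smooth approximation of the concave loss function `L`. -/
def smoothLoss (E : Environment) (L : ℝ → ℝ) (h ε x : ℝ) : ℝ :=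
  E.xlo + ∫ t in E.xlo..x, E.smoothSlope L h ε t

theorem continuous_smoothSlope (hL : E.IsLossFn L) : Continuous (E.smoothSlope L h ε) := by
  have := hL.continuous
  unfold smoothSlope
  fun_prop

theorem hasDerivAt_smoothLoss (hL : E.IsLossFn L) (x : ℝ) :
    HasDerivAt (E.smoothLoss L h ε) (E.smoothSlope L h ε x) x :=
  (intervalIntegral.integral_hasDerivAt_right
    ((continuous_smoothSlope hL).intervalIntegrable _ _)
    (continuous_smoothSlope hL).stronglyMeasurable.stronglyMeasurableAtFilter
    (continuous_smoothSlope hL).continuousAt).const_add _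

theorem quotient_mem (hL : E.IsLossFn L) (hh : 0 < h) (u : ℝ) :
    (L (u + h) - L u) / h ∈ Icc (0 : ℝ) 1 := by
  have h1 := hL.mono (show u ≤ u + h by linarith)
  have h2 := hL.lip u (u + h) (by linarith)
  exact ⟨div_nonneg (by linarith) hh.le, by rw [div_le_one hh]; linarith⟩

theorem smoothLoss_isSmoothLoss (hL : E.IsLossFn L) (hconc : ConcaveOn ℝ univ L) (hh : 0 < h)
    (hh' : h < E.xhi - E.xlo) (hε : 0 < ε) (hε' : ε < 1) :
    E.IsSmoothLoss (E.smoothLoss L h ε) (E.smoothSlope L h ε) (E.xlo + h) where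
  hasDerivAt := hasDerivAt_smoothLoss hL
  anti x z hxz := by
    have hm : max x (E.xlo + h) ≤ max z (E.xlo + h) := max_le_max hxz le_rfl
    have h1 := div_le_div_of_nonneg_right (antitone_increment_of_concaveOn hconc hh hm) hh.le
    have h2 : Real.exp (-(max z (E.xlo + h) - E.xlo)) ≤ Real.exp (-(max x (E.xlo + h) - E.xlo)) :=
      Real.exp_le_exp.2 (by linarith)
    exact add_le_add (mul_le_mul_of_nonneg_left h1 (by linarith))
      (mul_le_mul_of_nonneg_left h2 hε.le)
  pos x := add_pos_of_nonneg_of_pos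
    (mul_nonneg (by linarith) (quotient_mem hL hh (max x (E.xlo + h))).1)
    (mul_pos hε (Real.exp_pos _))
  lt_one x := by
    have h1 := (quotient_mem hL hh (max x (E.xlo + h))).2
    have h2 : Real.exp (-(max x (E.xlo + h) - E.xlo)) < 1 := by
      rw [← Real.exp_zero]
      exact Real.exp_lt_exp.2 (by linarith [le_max_right x (E.xlo + h)])
    have h3 := mul_le_mul_of_nonneg_left h1 (show 0 ≤ 1 - ε by linarith)
    have h4 := mul_lt_mul_of_pos_left h2 hε
    rw [smoothSlope]
    linarith
  mem := ⟨by linarith, by linarith⟩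
  const x hx := by
    rw [smoothSlope, smoothSlope, max_eq_right hx, max_eq_right (by linarith)]
  strictAnti x hx z hz hxz := by
    have h1 := div_le_div_of_nonneg_right (antitone_increment_of_concaveOn hconc hh hxz.le) hh.le
    have h2 : Real.exp (-(z - E.xlo)) < Real.exp (-(x - E.xlo)) :=
      Real.exp_lt_exp.2 (by linarith)
    rw [smoothSlope, smoothSlope, max_eq_left (mem_Ici.1 hx), max_eq_left (mem_Ici.1 hz)]
    exact add_lt_add_of_le_of_lt (mul_le_mul_of_nonneg_left h1 (by linarith))
      (mul_lt_mul_of_pos_left h2 hε)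
  at_lo := by simp [smoothLoss]

/-- The comparison goes through the moving average `A` of `L` over `[x, x + h]`, whose derivative is
the forward difference quotient. It is within `h` of `L` at each point; the slopes differ by at most
`1` on the frozen piece and by at most `ε` afterwards. This gives `3 * h + ε * (xhi - xlo)`. -/
theorem abs_smoothLoss_sub_le (hL : E.IsLossFn L) (hconc : ConcaveOn ℝ univ L) (hh : 0 < h)
    (hh' : h < E.xhi - E.xlo) (hε : 0 < ε) (hε' : ε < 1) {x : ℝ} (hx : x ∈ Icc E.xlo E.xhi) :
    |E.smoothLoss L h ε x - L x| ≤ 3 * h + ε * (E.xhi - E.xlo) := by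
  have hs := smoothLoss_isSmoothLoss hL hconc hh hh' hε hε'
  have hLc := hL.continuous
  set P : ℝ → ℝ := fun x => ∫ t in E.xlo..x, L t with hP
  have hPd : ∀ x, HasDerivAt P (L x) x := fun x =>
    intervalIntegral.integral_hasDerivAt_right (hLc.intervalIntegrable _ _)
      hLc.stronglyMeasurable.stronglyMeasurableAtFilter hLc.continuousAt
  set A : ℝ → ℝ := fun x => (P (x + h) - P x) / h with hA
  have hAd : ∀ x, HasDerivAt A ((L (x + h) - L x) / h) x := fun x =>
    (((hPd (x + h)).comp_add_const x h).sub (hPd x)).div_const h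
  have hAmem : ∀ x, L x ≤ A x ∧ A x ≤ L x + h := by
    intro x
    obtain ⟨t, ht, heq⟩ := exists_hasDerivAt_eq_slope P L (show x < x + h by linarith)
      (fun u _ => (hPd u).continuousAt.continuousWithinAt) (fun u _ => hPd u)
    rw [add_sub_cancel_left] at heq
    have h1 := hL.mono ht.1.le
    have h2 := hL.lip x t ht.1.le
    simp only [hA]
    rw [← heq]
    exact ⟨h1, by linarith [ht.2]⟩
  set D : ℝ → ℝ := fun x => E.smoothLoss L h ε x - A x with hD
  have hDd : ∀ x, HasDerivAt D (E.smoothSlope L h ε x - (L (x + h) - L x) / h) x := fun x =>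
    (hs.hasDerivAt x).sub (hAd x)
  have hb1 : ∀ t, ‖E.smoothSlope L h ε t - (L (t + h) - L t) / h‖ ≤ 1 := by
    intro t
    have h1 := quotient_mem hL hh t
    rw [Real.norm_eq_abs, abs_le]
    constructor <;> linarith [hs.pos t, hs.lt_one t, h1.1, h1.2]
  have hb2 : ∀ t ∈ Ici (E.xlo + h), ‖E.smoothSlope L h ε t - (L (t + h) - L t) / h‖ ≤ ε := by
    intro t ht
    have h1 := quotient_mem hL hh t
    have h2 : Real.exp (-(t - E.xlo)) ≤ 1 := Real.exp_le_one_iff.2 (by linarith [mem_Ici.1 ht])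
    have h3 := Real.exp_pos (-(t - E.xlo))
    rw [smoothSlope, max_eq_left ht, Real.norm_eq_abs, abs_le]
    constructor <;> nlinarith [h1.1, h1.2]
  have hd1 : ∀ u v, |D v - D u| ≤ 1 * |v - u| := fun u v =>
    convex_univ.norm_image_sub_le_of_norm_hasDerivWithin_le
      (fun t _ => (hDd t).hasDerivWithinAt) (fun t _ => hb1 t) (mem_univ u) (mem_univ v)
  have hd2 : ∀ u ∈ Ici (E.xlo + h), ∀ v ∈ Ici (E.xlo + h), |D v - D u| ≤ ε * |v - u| :=
    fun u hu v hv => (convex_Ici (E.xlo + h)).norm_image_sub_le_of_norm_hasDerivWithin_le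
      (fun t _ => (hDd t).hasDerivWithinAt) hb2 hu hv
  have hkey : |D x - D E.xlo| ≤ h + ε * (E.xhi - E.xlo) := by
    rcases le_total x (E.xlo + h) with hc | hc
    · have h1 := hd1 E.xlo x
      rw [abs_of_nonneg (show 0 ≤ x - E.xlo by linarith [hx.1])] at h1
      have : 0 ≤ ε * (E.xhi - E.xlo) := mul_nonneg hε.le (by linarith)
      linarith
    · have h1 := hd1 E.xlo (E.xlo + h)
      have h2 := hd2 (E.xlo + h) self_mem_Ici x hc
      rw [add_sub_cancel_left, abs_of_pos hh] at h1
      rw [abs_of_nonneg (show 0 ≤ x - (E.xlo + h) by linarith)] at h2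
      have h3 : ε * (x - (E.xlo + h)) ≤ ε * (E.xhi - E.xlo) :=
        mul_le_mul_of_nonneg_left (by linarith [hx.2]) hε.le
      have h4 := abs_sub_le (D x) (D (E.xlo + h)) (D E.xlo)
      linarith
  have hlo := hAmem E.xlo
  have hxA := hAmem x
  rw [hL.at_lo] at hlo
  simp only [hD, hs.at_lo] at hkey
  rw [abs_le] at hkey ⊢
  constructor <;> linarith [hkey.1, hkey.2, hlo.1, hlo.2, hxA.1, hxA.2]

/-- The optimal efforts given the smooth approximations converge. -/
theorem tendsto_bestEfforts_smoothLoss (hE : E.Admissible) (hL : E.IsLossFn L)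
    (hconc : ConcaveOn ℝ univ L) {h ε : ℕ → ℝ} (hh : ∀ n, 0 < h n)
    (hh' : ∀ n, h n < E.xhi - E.xlo) (hε : ∀ n, 0 < ε n) (hε' : ∀ n, ε n < 1)
    (hlim : Tendsto h atTop (𝓝 0)) (hεlim : Tendsto ε atTop (𝓝 0)) {x : ℝ}
    (hx : x ∈ Ioo E.xlo E.xhi) {q : ℝ × ℝ} (hq : E.IsBest L x q) :
    Tendsto (fun n => E.bestEfforts (E.smoothLoss L (h n) (ε n)) x) atTop (𝓝 q) ∧
      Tendsto (fun n => E.smoothLoss L (h n) (ε n) x) atTop (𝓝 (L x)) := by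
  have hxI := Ioo_subset_Icc_self hx
  have hs := fun n => smoothLoss_isSmoothLoss hL hconc (hh n) (hh' n) (hε n) (hε' n)
  have hbd : Tendsto (fun n => 3 * h n + ε n * (E.xhi - E.xlo)) atTop (𝓝 0) := by
    have := (hlim.const_mul 3).add (hεlim.mul_const (E.xhi - E.xlo))
    simpa using this
  have hunif : ∀ δ > 0, ∀ᶠ n in atTop, ∀ z ∈ Icc E.xlo E.xhi,
      |E.smoothLoss L (h n) (ε n) z - L z| ≤ δ := by
    intro δ hδ
    filter_upwards [hbd.eventually (gt_mem_nhds hδ)] with n hn z hz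
    exact (abs_smoothLoss_sub_le hL hconc (hh n) (hh' n) (hε n) (hε' n) hz).trans (le_of_lt hn)
  refine ⟨IsBest.tendsto hE (fun n => (hs n).isLossFn) hL (Eventually.of_forall fun _ => hxI) hxI
    tendsto_const_nhds hunif
    (Eventually.of_forall fun n => bestEfforts_spec hE (hs n).isLossFn hxI.1) hq
    fun δ hδ _ => ?_, ?_⟩
  -- If `L x = x`, closeness alone gives no slack near `x`. Instead, feasibility of `q` at type `x +
  -- h n` bounds the forward difference by `q.2`, and concavity bounds the slope of the
  -- approximation by `q.2 + δ`.
  · rcases (hL.le_self hxI.1).eq_or_lt with heq | hlt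
    · filter_upwards [hεlim.eventually (gt_mem_nhds hδ),
        hlim.eventually (gt_mem_nhds (show 0 < E.xhi - x by linarith [hx.2]))] with n hn1 hn2 z hz
      have h1 := (hs n).tangent_le x z
      have h2 := (hs n).isLossFn.le_self hxI.1
      have h3 := (hq.1.2.2 (x + h n) ⟨by linarith [hh n], by linarith⟩).1
      have h4 := div_le_div_of_nonneg_right
        (antitone_increment_of_concaveOn hconc (hh n) (le_max_left x (E.xlo + h n))) (hh n).le
      have h5 : (L (x + h n) - L x) / h n ≤ q.2 := by
        rw [div_le_iff₀ (hh n)]; linarith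
      have h6 := (quotient_mem hL (hh n) (max x (E.xlo + h n))).1
      have h7 : Real.exp (-(max x (E.xlo + h n) - E.xlo)) ≤ 1 :=
        Real.exp_le_one_iff.2 (by linarith [le_max_left x (E.xlo + h n), hx.1])
      have h8 : E.smoothSlope L (h n) (ε n) x ≤ q.2 + δ := by
        have h9 := mul_le_mul_of_nonneg_left h7 (hε n).le
        have h10 := mul_nonneg (hε n).le h6
        have h11 : (L (max x (E.xlo + h n) + h n) - L (max x (E.xlo + h n))) / h n ≤ q.2 :=
          h4.trans h5
        rw [smoothSlope]
        linarith
      have := mul_le_mul_of_nonneg_right h8 (sub_nonneg.2 hz.1)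
      linarith
    · exact eventually_le_of_lt_self (fun n => (hs n).isLossFn) hL
        (Eventually.of_forall fun _ => hxI) tendsto_const_nhds hunif hlt hq.1.2.1
        (fun z hz => (hq.1.2.2 z hz).1) hδ
  · rw [Metric.tendsto_nhds]
    intro δ hδ
    filter_upwards [hunif (δ / 2) (by positivity)] with n hn
    rw [Real.dist_eq]
    linarith [hn x hxI]

end Approximation

end Environment

end TaxAudit

end

/-! ### The approximating sequence -/

theorem mainTheorem9 (E : TaxAudit.Environment) (hE : E.Admissible)
    (m : TaxAudit.TaxMechanism) (hopt : E.IsOptimal m) (htight : E.IsTight m) :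
    ∃ M : ℕ → TaxAudit.TaxMechanism,
      (∀ n, E.IsTight (M n) ∧ E.DoublyUnique (M n) ∧
        (∀ x ∈ Ico E.xlo E.xhi, (M n).eP x ∈ Ioo (0 : ℝ) 1) ∧
        StrictAntiOn (M n).eP (Ico E.xlo E.xhi)) ∧
      ∀ x ∈ Ioo E.xlo E.xhi,
        Tendsto (fun n => ((M n).eA x, (M n).eP x, E.profit (M n) x)) atTop
          (𝓝 (m.eA x, m.eP x, E.profit m x)) := by
  have hself : ∀ x ∈ Icc E.xlo E.xhi, E.loss m x ≤ x := fun x hx =>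
    TaxAudit.Environment.loss_le_self hE htight.1.1 hx
  have hL := TaxAudit.Environment.lossHull_isLossFn hself
  have hconc := TaxAudit.Environment.lossHull_concave hself
  have hlt := hE.xlo_lt_xhi
  -- The shift by `2` keeps `ε n < 1` and `h n < xhi - xlo` already at `n = 0`.
  have hn : ∀ n : ℕ, (1 : ℝ) < (n : ℝ) + 2 := fun n => by
    have : (0 : ℝ) ≤ n := n.cast_nonneg
    linarith
  have hε : ∀ n : ℕ, 0 < 1 / ((n : ℝ) + 2) := fun n => by have := hn n; positivity
  have hε' : ∀ n : ℕ, 1 / ((n : ℝ) + 2) < 1 := fun n => by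
    rw [div_lt_one (by linarith [hn n])]; exact hn n
  have hh : ∀ n : ℕ, 0 < (E.xhi - E.xlo) * (1 / ((n : ℝ) + 2)) := fun n =>
    mul_pos (by linarith) (hε n)
  have hh' : ∀ n : ℕ, (E.xhi - E.xlo) * (1 / ((n : ℝ) + 2)) < E.xhi - E.xlo := fun n =>
    mul_lt_of_lt_one_right (by linarith) (hε' n)
  have hεlim : Tendsto (fun n : ℕ => 1 / ((n : ℝ) + 2)) atTop (𝓝 0) := by
    have := (tendsto_natCast_atTop_atTop (R := ℝ)).atTop_add
      (tendsto_const_nhds (x := (2 : ℝ)))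
    simpa [Pi.inv_def] using this.inv_tendsto_atTop
  have hlim : Tendsto (fun n : ℕ => (E.xhi - E.xlo) * (1 / ((n : ℝ) + 2))) atTop (𝓝 0) := by
    simpa using hεlim.const_mul (E.xhi - E.xlo)
  have hs := fun n : ℕ => TaxAudit.Environment.smoothLoss_isSmoothLoss hL hconc (hh n) (hh' n)
    (hε n) (hε' n)
  refine ⟨fun n => E.implement (E.smoothLoss (E.lossHull (E.loss m)) _ _),
    fun n => ⟨(hs n).isTight hE, (hs n).doublyUnique hE, fun x hx => ?_,
      (hs n).strictAntiOn_snd hE⟩, fun x hx => ?_⟩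
  · have hq := TaxAudit.Environment.bestEfforts_spec hE (hs n).isLossFn hx.1
    exact ⟨hq.snd_pos hE (hs n) hx, hq.snd_lt_one hE (hs n) hx⟩
  · have hxI := Ioo_subset_Icc_self hx
    obtain ⟨hbest, hprofit⟩ := htight.isBest hE hxI
    obtain ⟨hQ, hv⟩ := TaxAudit.Environment.tendsto_bestEfforts_smoothLoss hE hL hconc hh hh' hε
      hε' hlim hεlim hx hbest
    have hcost := TaxAudit.Environment.tendsto_auditCost hE hv (tendsto_const_nhds (x := x)) hQ
      (Eventually.of_forall fun n =>
        have hq := TaxAudit.Environment.bestEfforts_spec hE (hs n).isLossFn hxI.1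
        ⟨hq.1.1, hq.1.2.1⟩) ⟨hbest.1.1, hbest.1.2.1⟩
    have hQ1 := (continuous_fst.tendsto _).comp hQ
    have hQ2 := (continuous_snd.tendsto _).comp hQ
    have hpr := hcost.neg
    rw [← hprofit] at hpr
    refine hQ1.prodMk_nhds (hQ2.prodMk_nhds (hpr.congr fun n => ?_))
    exact (TaxAudit.Environment.implement_profit hE (hs n).isLossFn hxI.1).symm
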